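/- Let $j\ge 1$ be an odd integer and $a,b,\alpha\in\mathbb R$. Write $(x)_k=x(x+1)\cdots(x+k-1)$. **Notation.** For $\rho_1,\rho_2,r_1,r_2\in\mathbb R$ put $g=\rho_1+\rho_2-r_1-r_2$ and $$A_n=\begin{cases}-\frac{(n+2\rho_2-2r_2+1)(n+2\rho_2-2r_1+1)}{4(n+g+1)}&n\text{ even}\\-\frac{(n+1)(n-2r_1-2r_2+1)}{4(n+g+1)}&n\text{ odd}\end{cases},\qquad C_n=\begin{cases}\frac{(n+2\rho_1-2r_1+1)(n+2\rho_1-2r_2+1)}{4(n+g+1)}&n\text{ even}\\\frac{(n+2g+1)(n+2\rho_1+2\rho_2+1)}{4(n+g+1)}&n\text{ odd.}\end{cases}$$ The general complementary Bannai–Ito polynomials are the monic polynomials with $\mathbf I_0=1$, $\mathbf I_{-1}=0$, $x\mathbf I_n=\mathbf I_{n+1}+(\rho_1-A_n-C_n)\mathbf I_n+A_{n-1}C_n\mathbf I_{n-1}$, and the general Bannai–Ito polynomials are $\mathbf B_n=\mathbf I_n-A_{n-1}\mathbf I_{n-1}$ ($\mathbf B_0=1$). Let $$A_n^3=\begin{cases}\frac14\frac{(n-j+a)(n-j+b)}{n-j}&n\text{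 even}\\\frac14(n-2j-1)&n\text{ odd},\ n\ne j\\-\frac12\alpha(j+1)&n=j\end{cases},\qquad C_n^3=\begin{cases}-\frac14 n&n\text{ even},\ n\neq j+1\\-\frac14\frac{(n-j-1-a)(n-j-1-b)}{n-j-1}&n\text{ odd}\\-\frac12(1-\alpha)(j+1)&n=j+1,\end{cases}$$ and let $\mathbf P^{(3)}_n$ be the polynomials with $\mathbf P^{(3)}_0=1$, $\mathbf P^{(3)}_{-1}=0$, $$x\mathbf P^{(3)}_n=\mathbf P^{(3)}_{n+1}+\Big(\tfrac{b-j-1+a}4-A_n^3-C_n^3\Big)\mathbf P^{(3)}_n+A_{n-1}^3C_n^3\,\mathbf P^{(3)}_{n-1}.\qquad(1)$$ Let $\mathbf P^{(2)}_n$ be defined by the same recurrence with $A^3,C^3$ replaced by $$A_n^2=\begin{cases}-\frac14\frac{(n-j-a)(n-j-b)}{n-j}&n\text{ even}\\-\frac14(n+1)&n\text{ odd},\ n\neq j\\-\frac12(1-\alpha)(j+1)&n=j\end{cases},\qquad C_n^2=\begin{cases}\frac14\frac{(n-j+a)(n-j+b)}{n-j}&n\text{ even}\\\frac14(n-2j-1)&n\text{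 odd},\ n\neq j\\-\frac12\alpha(j+1)&n=j.\end{cases}$$ Then the following hold. 1. **Truncation and recurrence.** Let $e_1,e_2\in\mathbb R$ with $e_1+e_2\neq0$ and $\alpha=e_1/(e_1+e_2)$, and let $\rho_1=\frac{b-j-1+a}4$, $-r_1=\frac{b-j-1-a}4$, $\rho_1+\rho_2(t)=-\frac{j+1}2+e_1t$, $-r_1-r_2(t)=-\frac{j+1}2+e_2t$. As $t\to0$, $t\neq 0$, for all $n\geq0$: $C_n\to A_n^3$, $A_n\to C_{n+1}^3$, and $\mathbf B_n(x;\rho_1,\rho_2(t),r_1,r_2(t))\to\mathbf P_n^{(3)}(x)$ for every $x\in\mathbb R$. Each $\mathbf P^{(3)}_n$ is monic of degree $n$ and (1) holds for all $n\ge0$; moreover $C_0^3=0$ and $A^3_{2j+1}=0$. 2. **Positivity.** Let $u_n=A_{n-1}^3C_n^3$. Then $u_n>0$ for all $1\le n\le 2j+1$ if and only if $0<\alpha<1$ and either $|a|>j,\ |b|<1$ or $|a|<1,\ |b|>j$. If $0\le\alpha\le1$ and either $|a|\ge j,\ |b|\le1$ or $|a|\le1,\ |b|\ge j$, then $u_n\ge0$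 for all $1\le n\le 2j+1$. 3. **Dunkl-difference equation.** Let $Rf(x)=f(-x)$, $T^+f(x)=f(x+1)$ and $L=F(x)(I-R)+G(x)(T^+R-I)$ with $$G(x)=\frac{(4x+1+b-a-j)(4x+1+a-b-j)}{16(2x+1)},\qquad F(x)=\frac{(4x+j+1-a-b)(4x+j+1+a+b)}{32x}.$$ For $0\le n\le j$ and all $x\in\mathbb R\setminus\{0,-\frac12\}$: $L\mathbf P^{(3)}_{2n}(x)=n\,\mathbf P^{(3)}_{2n}(x)$ and $L\mathbf P^{(3)}_{2n+1}(x)=(j-n)\,\mathbf P^{(3)}_{2n+1}(x)$. 4. **Relation with $\mathbf P^{(2)}$.** $\mathbf P^{(3)}_0=\mathbf P^{(2)}_0$ and $\mathbf P_n^{(3)}=\mathbf P_n^{(2)}-C_n^3\,\mathbf P_{n-1}^{(2)}$ for all $n\ge1$. 5. **Orthogonality.** Suppose $0\le\alpha\le1$ and either $|a|>j,\ |b|<1$ or $|a|<1,\ |b|>j$. For $s\in\{0,1,\dots,\frac{j-1}2\}$ let $$x_{4s}=-\tfrac{4s-j+a-b}4-\tfrac14,\quad x_{4s+1}=\tfrac{4s-j-a-b}4-\tfrac14,\quad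 x_{4s+2}=\tfrac{4s+2-j+a-b}4-\tfrac14,\quad x_{4s+3}=-\tfrac{4s+2-j-a-b}4-\tfrac14 .$$ These $2j+2$ points are pairwise distinct and $\mathbf P^{(3)}_{2j+2}(x)=\prod_{i=0}^{2j+1}(x-x_i)$. Put $$h_{2n}=\frac{\sqrt{(-j)_n(1)_n(-\frac{j-a}2)_n(-\frac{j+a}2)_n(-\frac{j-b}2)_n(-\frac{j+b}2)_n}}{2^{2n}\,|(-\frac j2)_n|}\,\theta_n,$$ $$h_{2n+1}=\frac{\sqrt{(-1)(-j)_n(1)_n(-\frac{j-a}2)_{n+1}(-\frac{j+a}2)_{n+1}(-\frac{j-b}2)_{n+1}(-\frac{j+b}2)_{n+1}}}{2^{2n+1}\,|(-\frac j2)_{n+1}|}\,\theta_n,$$ where $\theta_n=1$ for $n<\frac{j+1}2$ and $\theta_n=2\sqrt{\alpha(1-\alpha)}$ for $n\ge\frac{j+1}2$. Let $H$ be the value of $h_{2j+1}$ at $\alpha=\frac12$ (that is, with $\theta_j=1$), put $k=\frac{j+1}2$, and $$w_{4s}=\frac{2\alpha H}{(-s)_s(1)_{\frac{j-1}2-s}(-s+\frac{1-a}2)_k(s+\frac{1+a-b-j}2)_k(s-\frac{b+j}2)_k},$$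 $$w_{4s+1}=\frac{2(1-\alpha)H}{(-s)_s(1)_{\frac{j-1}2-s}(-s+\frac{1+a}2)_k(s+\frac{1-a-b-j}2)_k(s-\frac{b+j}2)_k},$$ $$w_{4s+2}=-\frac{2\alpha H}{(-s)_s(1)_{\frac{j-1}2-s}(-s-\frac{1+a}2)_k(s+\frac{1+a-b-j}2)_k(s+\frac{2-b-j}2)_k},$$ $$w_{4s+3}=-\frac{2(1-\alpha)H}{(-s)_s(1)_{\frac{j-1}2-s}(-s-\frac{1-a}2)_k(s+\frac{1-a-b-j}2)_k(s+\frac{2-b-j}2)_k}.$$ Then $h_n^2=u_1u_2\cdots u_n$ for $0\le n\le 2j+1$, and for all $0\le n,m\le 2j+1$ $$\sum_{i=0}^{2j+1}w_i\,\mathbf P^{(3)}_n(x_i)\,\mathbf P^{(3)}_m(x_i)=h_n^2\,\delta_{nm}.$$ -/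

import Mathlib

open Polynomial Filter Topology

noncomputable section

namespace ParaBI

/-- The monic polynomials determined by the three-term recurrence
`x p_n = p_{n+1} + β_n p_n + u_n p_{n-1}`, `p_0 = 1`, `p_{-1} = 0`. -/
def monicRec (β u : ℕ → ℝ) : ℕ → ℝ[X]
  | 0 => 1
  | 1 => X - C (β 0)
  | n + 2 => (X - C (β (n + 1))) * monicRec β u (n + 1) - C (u (n + 1)) * monicRec β u n

/-- Pochhammer symbol `(x)_k = x (x+1) ... (x+k-1)`. -/
def poch (x : ℝ) (k : ℕ) : ℝ := ∏ i ∈ Finset.range k, (x + i)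

/-! ### General complementary Bannai-Ito and general Bannai-Ito polynomials -/

/-- The coefficient `A_n` of the general (complementary) Bannai-Ito polynomials,
with `g = ρ₁ + ρ₂ - r₁ - r₂`. -/
def genA (ρ₁ ρ₂ r₁ r₂ : ℝ) (n : ℕ) : ℝ :=
  if Even n then
    -((n + 2 * ρ₂ - 2 * r₂ + 1) * (n + 2 * ρ₂ - 2 * r₁ + 1)
      / (4 * (n + (ρ₁ + ρ₂ - r₁ - r₂) + 1)))
  else
    -((n + 1) * (n - 2 * r₁ - 2 * r₂ + 1) / (4 * (n + (ρ₁ + ρ₂ - r₁ - r₂) + 1)))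

/-- The coefficient `C_n` of the general (complementary) Bannai-Ito polynomials. -/
def genC (ρ₁ ρ₂ r₁ r₂ : ℝ) (n : ℕ) : ℝ :=
  if Even n then
    (n + 2 * ρ₁ - 2 * r₁ + 1) * (n + 2 * ρ₁ - 2 * r₂ + 1)
      / (4 * (n + (ρ₁ + ρ₂ - r₁ - r₂) + 1))
  else
    (n + 2 * (ρ₁ + ρ₂ - r₁ - r₂) + 1) * (n + 2 * ρ₁ + 2 * ρ₂ + 1)
      / (4 * (n + (ρ₁ + ρ₂ - r₁ - r₂) + 1))

/-- The monic general complementary Bannai-Ito polynomials: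
`x I_n = I_{n+1} + (ρ₁ - A_n - C_n) I_n + A_{n-1} C_n I_{n-1}`. -/
def genI (ρ₁ ρ₂ r₁ r₂ : ℝ) : ℕ → ℝ[X] :=
  monicRec (fun n => ρ₁ - genA ρ₁ ρ₂ r₁ r₂ n - genC ρ₁ ρ₂ r₁ r₂ n)
    (fun n => genA ρ₁ ρ₂ r₁ r₂ (n - 1) * genC ρ₁ ρ₂ r₁ r₂ n)

/-- The monic general Bannai-Ito polynomials, `B_n = I_n - A_{n-1} I_{n-1}` (and `B_0 = I_0`). -/
def genB (ρ₁ ρ₂ r₁ r₂ : ℝ) : ℕ → ℝ[X]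
  | 0 => genI ρ₁ ρ₂ r₁ r₂ 0
  | n + 1 => genI ρ₁ ρ₂ r₁ r₂ (n + 1) - C (genA ρ₁ ρ₂ r₁ r₂ n) * genI ρ₁ ρ₂ r₁ r₂ n

/-! ### The para-Bannai-Ito polynomials for `N = 2j`, `j` odd -/

/-- The coefficient `A_n^2`. -/
def A2 (j : ℕ) (a b α : ℝ) (n : ℕ) : ℝ :=
  if Even n then -(1 / 4) * ((n - j - a) * (n - j - b) / (n - j))
  else if n = j then -(1 / 2) * (1 - α) * (j + 1)
  else -(1 / 4) * (n + 1)

/-- The coefficient `C_n^2`. -/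
def C2 (j : ℕ) (a b α : ℝ) (n : ℕ) : ℝ :=
  if Even n then 1 / 4 * ((n - j + a) * (n - j + b) / (n - j))
  else if n = j then -(1 / 2) * α * (j + 1)
  else 1 / 4 * (n - 2 * j - 1)

/-- The polynomials `P^(2)_n`. -/
def P2 (j : ℕ) (a b α : ℝ) : ℕ → ℝ[X] :=
  monicRec (fun n => (b - j - 1 + a) / 4 - A2 j a b α n - C2 j a b α n)
    (fun n => A2 j a b α (n - 1) * C2 j a b α n)

/-! ### The para-Bannai-Ito polynomials for `N = 2j + 1`, `j` odd -/

/-- The coefficient `A_n^3`. -/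
def A3 (j : ℕ) (a b α : ℝ) (n : ℕ) : ℝ :=
  if Even n then 1 / 4 * ((n - j + a) * (n - j + b) / (n - j))
  else if n = j then -(1 / 2) * α * (j + 1)
  else 1 / 4 * (n - 2 * j - 1)

/-- The coefficient `C_n^3`. -/
def C3 (j : ℕ) (a b α : ℝ) (n : ℕ) : ℝ :=
  if Even n then
    if n = j + 1 then -(1 / 2) * (1 - α) * (j + 1) else -(1 / 4) * n
  else -(1 / 4) * ((n - j - 1 - a) * (n - j - 1 - b) / (n - j - 1))

/-- The recurrence coefficient `u_n = A_{n-1}^3 C_n^3`, used for `n ≥ 1`. -/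
def u3 (j : ℕ) (a b α : ℝ) (n : ℕ) : ℝ := A3 j a b α (n - 1) * C3 j a b α n

/-- The polynomials `P^(3)_n`. -/
def P3 (j : ℕ) (a b α : ℝ) : ℕ → ℝ[X] :=
  monicRec (fun n => (b - j - 1 + a) / 4 - A3 j a b α n - C3 j a b α n) (u3 j a b α)

/-- The reflection `R f(x) = f(-x)`. -/
def reflR (f : ℝ → ℝ) : ℝ → ℝ := fun x => f (-x)

/-- The shift `T⁺ f(x) = f(x+1)`. -/
def shiftT (f : ℝ → ℝ) : ℝ → ℝ := fun x => f (x + 1)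

def dunklF (j : ℕ) (a b x : ℝ) : ℝ :=
  (4 * x + j + 1 - a - b) * (4 * x + j + 1 + a + b) / (32 * x)

def dunklG (j : ℕ) (a b x : ℝ) : ℝ :=
  (4 * x + 1 + b - a - j) * (4 * x + 1 + a - b - j) / (16 * (2 * x + 1))

/-- The Dunkl-difference operator `L = F(x) (I - R) + G(x) (T⁺ R - I)`. Its coefficients have poles
at `x = 0` and `x = -1/2`. -/
def dunklL (j : ℕ) (a b : ℝ) (f : ℝ → ℝ) : ℝ → ℝ := fun x =>
  dunklF j a b x * (f x - reflR f x) + dunklG j a b x * (shiftT (reflR f) x - f x)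

/-- The grid points `x_i`, with `i = 4s + i % 4` and `s = i / 4`. -/
def grid (j : ℕ) (a b : ℝ) (i : ℕ) : ℝ :=
  let s : ℝ := ((i / 4 : ℕ) : ℝ)
  if i % 4 = 0 then -((4 * s - j + a - b) / 4) - 1 / 4
  else if i % 4 = 1 then (4 * s - j - a - b) / 4 - 1 / 4
  else if i % 4 = 2 then (4 * s + 2 - j + a - b) / 4 - 1 / 4
  else -((4 * s + 2 - j - a - b) / 4) - 1 / 4

/-- The nonnegative numbers `h_n`; here `n = 2k` or `n = 2k + 1` with `k = n / 2`. -/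
def norm3 (j : ℕ) (a b α : ℝ) (n : ℕ) : ℝ :=
  let k : ℕ := n / 2
  (if Even n then
      √(poch (-j) k * poch 1 k * poch (-((j - a) / 2)) k * poch (-((j + a) / 2)) k
          * poch (-((j - b) / 2)) k * poch (-((j + b) / 2)) k)
        / (2 ^ (2 * k) * |poch (-(j / 2)) k|)
    else
      √((-1) * poch (-j) k * poch 1 k * poch (-((j - a) / 2)) (k + 1)
          * poch (-((j + a) / 2)) (k + 1) * poch (-((j - b) / 2)) (k + 1)
          * poch (-((j + b) / 2)) (k + 1))
        / (2 ^ (2 * k + 1) * |poch (-(j / 2)) (k + 1)|))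
    * (if k < (j + 1) / 2 then 1 else 2 * √(α * (1 - α)))

/-- The weights `w_i`, with `i = 4s + i % 4` and `s = i / 4`. The constant in the numerators is
`h_{2j+1}` taken at the persymmetric value `α = 1/2`. -/
def weight (j : ℕ) (a b α : ℝ) (i : ℕ) : ℝ :=
  let m : ℕ := i / 4
  let s : ℝ := (m : ℝ)
  let k : ℕ := (j + 1) / 2
  let H : ℝ := norm3 j a b (1 / 2) (2 * j + 1)
  if i % 4 = 0 then
    2 * α * H / (poch (-s) m * poch 1 ((j - 1) / 2 - m) * poch (-s + (1 - a) / 2) k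
      * poch (s + (1 + a - b - j) / 2) k * poch (s - (b + j) / 2) k)
  else if i % 4 = 1 then
    2 * (1 - α) * H / (poch (-s) m * poch 1 ((j - 1) / 2 - m) * poch (-s + (1 + a) / 2) k
      * poch (s + (1 - a - b - j) / 2) k * poch (s - (b + j) / 2) k)
  else if i % 4 = 2 then
    -(2 * α * H / (poch (-s) m * poch 1 ((j - 1) / 2 - m) * poch (-s - (1 + a) / 2) k
      * poch (s + (1 + a - b - j) / 2) k * poch (s + (2 - b - j) / 2) k))
  else
    -(2 * (1 - α) * H / (poch (-s) m * poch 1 ((j - 1) / 2 - m) * poch (-s - (1 - a) / 2) k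
      * poch (s + (1 - a - b - j) / 2) k * poch (s + (2 - b - j) / 2) k))

end ParaBI

end

namespace ParaBI

/-! ### Monic three-term recurrences -/

/-! Everything follows from two factorizations and a reversal of one Jacobi matrix $J$, that of
$P=\mathbf P^{(3)}$. Since $C_0^3=0$, $J-\rho$ with $\rho=\frac{b-j-1+a}4$ factors into bidiagonal
matrices; exchanging the factors gives the kernel polynomials, which are $\mathbf P^{(2)}$
(`darboux_relations`). Their diagonal alternates between $\kappa$ and $-\kappa$, so they are even
functions, times $x-\kappa$ in odd degree (`monicRec_reflection`). Hence the reflection $x\mapsto-x$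
acts on $P_n$ in closed form.

The substitution $b\mapsto-b$, $\alpha\mapsto1-\alpha$, with the signs of $A^3,C^3$ reversed, gives
a second factorization of the same $J$ (`P3_eq_darboux_dual`), now adapted to $x\mapsto-1-x$. Adding
the two reflection identities cancels the neighbouring polynomials and leaves the Dunkl-difference
equation. Because $A^3_{2j+1}=0$, both reflections also permute the roots of $P_{2j+2}$, apart from
two exceptional roots each, and preserve the value of $P_{2j+1}$. Two chains of alternating
reflections therefore produce all $2j+2$ roots, with one value of $P_{2j+1}$ on each chain
(`P3_eval_grid`).

Orthogonality comes from reversal: reading $J$ backwards replaces $\alpha$ by $1-\alpha$, so at a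
root of $P_{2j+2}$ one has $P_{2j+1}^{1-\alpha}P_n^{\alpha}=u_1\cdots u_n\,P_{2j+1-n}^{1-\alpha}$
(`P3_last_mul_eval`). The weights are $P_{2j+1}^{1-\alpha}(x_i)/P_{2j+2}'(x_i)$ (`weight_eq`), so
for $m\le n$ the sum is $h_n^2$ times a divided difference, that is, the coefficient of $x^{2j+1}$
in a monic product of degree $2j+1-n+m$. No division by $u_n$ occurs, so $\alpha=0,1$ are included.
-/

lemma monicRec_add_two (β u : ℕ → ℝ) (n : ℕ) :
    monicRec β u (n + 2) =
      (X - C (β (n + 1))) * monicRec β u (n + 1) - C (u (n + 1)) * monicRec β u n := rfl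

/-- The value `u 0` never enters the recurrence, so the truncated index `0 - 1` in coefficients such
as $A_{n-1}C_n$ is harmless. -/
lemma monicRec_congr {β β' u u' : ℕ → ℝ} (hβ : ∀ n, β n = β' n)
    (hu : ∀ n, u (n + 1) = u' (n + 1)) (n : ℕ) : monicRec β u n = monicRec β' u' n := by
  induction n using Nat.twoStepInduction with
  | zero => rfl
  | one => simp only [monicRec, hβ]
  | more n h0 h1 => simp only [monicRec_add_two, h0, h1, hβ, hu]

lemma monicRec_monic_natDegree (β u : ℕ → ℝ) (n : ℕ) :
    (monicRec β u n).Monic ∧ (monicRec β u n).natDegree = n := by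
  induction n using Nat.twoStepInduction with
  | zero => exact ⟨monic_one, natDegree_one⟩
  | one => exact ⟨monic_X_sub_C _, natDegree_X_sub_C _⟩
  | more n h0 h1 =>
    have hm : ((X - C (β (n + 1))) * monicRec β u (n + 1)).Monic :=
      (monic_X_sub_C _).mul h1.1
    have hd : ((X - C (β (n + 1))) * monicRec β u (n + 1)).natDegree = n + 2 := by
      rw [(monic_X_sub_C _).natDegree_mul h1.1, natDegree_X_sub_C, h1.2]; omega
    have hlt : (C (u (n + 1)) * monicRec β u n).natDegree
        < ((X - C (β (n + 1))) * monicRec β u (n + 1)).natDegree := by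
      have := natDegree_C_mul_le (u (n + 1)) (monicRec β u n)
      omega
    rw [monicRec_add_two]
    exact ⟨hm.sub_of_left (degree_lt_degree hlt), by
      rw [natDegree_sub_eq_left_of_natDegree_lt hlt, hd]⟩

lemma tendsto_eval_monicRec {ι : Type*} {l : Filter ι} {β u : ι → ℕ → ℝ} {β' u' : ℕ → ℝ}
    (hβ : ∀ n, Tendsto (fun t => β t n) l (𝓝 (β' n)))
    (hu : ∀ n, Tendsto (fun t => u t (n + 1)) l (𝓝 (u' (n + 1)))) (x : ℝ) (n : ℕ) :
    Tendsto (fun t => (monicRec (β t) (u t) n).eval x) l (𝓝 ((monicRec β' u' n).eval x)) := by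
  induction n using Nat.twoStepInduction with
  | zero => simpa [monicRec] using tendsto_const_nhds
  | one => simpa [monicRec] using tendsto_const_nhds.sub (hβ 0)
  | more n h0 h1 =>
    simp only [monicRec_add_two, eval_sub, eval_mul, eval_X, eval_C]
    exact ((tendsto_const_nhds.sub (hβ _)).mul h1).sub ((hu _).mul h0)

/-- If the diagonal coefficients alternate between `c` and `q - c`, the polynomials are, up to a
linear factor in odd degree, invariant under `x ↦ q - x`. -/
lemma monicRec_reflection {β u : ℕ → ℝ} {c q : ℝ}
    (hβ : ∀ n, β n = if Even n then c else q - c) (n : ℕ) :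
    (∀ x, (monicRec β u (2 * n)).eval (q - x) = (monicRec β u (2 * n)).eval x) ∧
      ∃ V : ℝ[X], monicRec β u (2 * n + 1) = (X - C c) * V ∧ ∀ x, V.eval (q - x) = V.eval x := by
  induction n with
  | zero => exact ⟨by simp [monicRec], 1, by simp [monicRec, hβ], by simp⟩
  | succ n ih =>
    obtain ⟨h0, V, hV, hVx⟩ := ih
    -- Two consecutive linear factors multiply to $(x-c)(x-(q-c))$, which is invariant under
    -- $x\mapsto q-x$.
    have h2 : monicRec β u (2 * (n + 1))
        = (X - C (q - c)) * ((X - C c) * V) - C (u (2 * n + 1)) * monicRec β u (2 * n) := by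
      rw [show 2 * (n + 1) = 2 * n + 2 by ring, monicRec_add_two, hV, hβ, if_neg (by simp)]
    have h2x : ∀ x, (monicRec β u (2 * (n + 1))).eval (q - x)
        = (monicRec β u (2 * (n + 1))).eval x := by
      intro x
      simp only [h2, eval_sub, eval_mul, eval_X, eval_C, h0, hVx]
      ring
    refine ⟨h2x, monicRec β u (2 * (n + 1)) - C (u (2 * n + 2)) * V, ?_, fun x => ?_⟩
    · rw [show 2 * (n + 1) + 1 = 2 * n + 1 + 2 by ring, monicRec_add_two, hV, hβ,
        if_pos (by simp [parity_simps]), show 2 * n + 1 + 1 = 2 * (n + 1) by ring]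
      ring
    · simp [h2x, hVx]

/-! ### Christoffel and Geronimus transforms -/

/-- The polynomials with coefficients `β_n = ρ - A_n - C_n` and `u_n = A_{n-1} C_n`. -/
noncomputable def darboux (ρ : ℝ) (A C : ℕ → ℝ) : ℕ → ℝ[X] :=
  monicRec (fun n => ρ - A n - C n) (fun n => A (n - 1) * C n)

/-- The kernel polynomials of `darboux ρ A C` at `ρ`. -/
noncomputable def kernelPoly (ρ : ℝ) (A C : ℕ → ℝ) : ℕ → ℝ[X] :=
  monicRec (fun n => ρ - A n - C (n + 1)) (fun n => C n * A n)

/-- The recurrence reads $(x-\rho)P_n=(P_{n+1}-a_nP_n)-c_n(P_n-a_{n-1}P_{n-1})$, with $c_0=0$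
closing it at $n=0$. The two identities are the bidiagonal factors; each feeds the induction step of
the other. -/
lemma darboux_relations (ρ : ℝ) (a c : ℕ → ℝ) (h0 : c 0 = 0) (n : ℕ) :
    darboux ρ a c (n + 1) = kernelPoly ρ a c (n + 1) - C (c (n + 1)) * kernelPoly ρ a c n ∧
      (X - C ρ) * kernelPoly ρ a c n = darboux ρ a c (n + 1) - C (a n) * darboux ρ a c n := by
  induction n with
  | zero =>
    constructor <;>
    · simp only [darboux, kernelPoly, monicRec, h0, C_sub, C_0]
      ring
  | succ n ih =>
    obtain ⟨h1, h2⟩ := ih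
    have hP : darboux ρ a c (n + 2) = (X - C (ρ - a (n + 1) - c (n + 1))) * darboux ρ a c (n + 1)
      - C (a n * c (n + 1)) * darboux ρ a c n := rfl
    have hK : kernelPoly ρ a c (n + 2) = (X - C (ρ - a (n + 1) - c (n + 2)))
      * kernelPoly ρ a c (n + 1) - C (c (n + 1) * a (n + 1)) * kernelPoly ρ a c n := rfl
    simp only [C_sub, C_mul] at hP hK
    have h3 : (X - C ρ) * kernelPoly ρ a c (n + 1)
        = darboux ρ a c (n + 2) - C (a (n + 1)) * darboux ρ a c (n + 1) := by
      rw [hP]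
      linear_combination (C ρ - X) * h1 + C (c (n + 1)) * h2
    refine ⟨?_, h3⟩
    rw [hK]
    linear_combination -h3 + C (a (n + 1)) * h1

lemma eval_darboux_root (ρ : ℝ) (a c : ℕ → ℝ) (h0 : c 0 = 0) (n : ℕ) :
    (darboux ρ a c n).eval ρ = ∏ i ∈ Finset.range n, a i := by
  induction n with
  | zero => simp [darboux, monicRec]
  | succ n ih =>
    have h := congrArg (eval ρ) (darboux_relations ρ a c h0 n).2
    simp only [eval_sub, eval_mul, eval_X, eval_C, sub_self, zero_mul, ih] at h
    rw [Finset.prod_range_succ]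
    linarith

/-! ### Action of a reflection on the factored polynomials -/

section Reflection

variable {ρ κ q : ℝ} {a c : ℕ → ℝ}

/-- In the difference the symmetric $K_{2n}$ cancels and $K_{2n+1}=(x-\kappa)V$ contributes
$(2x-q)V$. The factor $(x-\rho)(x-\kappa)$ turns $V$ into $(x-\rho)K_{2n+1}$, which the Christoffel
relation evaluates. -/
lemma darboux_reflection_odd (h0 : c 0 = 0)
    (hβ : ∀ n, ρ - a n - c (n + 1) = if Even n then κ else q - κ) (n : ℕ) (x : ℝ) :
    (x - ρ) * (x - κ) * ((darboux ρ a c (2 * n + 1)).eval x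
        - (darboux ρ a c (2 * n + 1)).eval (q - x))
      = (2 * x - q) * ((darboux ρ a c (2 * n + 2)).eval x
        - a (2 * n + 1) * (darboux ρ a c (2 * n + 1)).eval x) := by
  obtain ⟨he, V, hV, hVx⟩ := monicRec_reflection (u := fun n => c n * a n) hβ n
  change kernelPoly ρ a c (2 * n + 1) = _ at hV
  change ∀ x, (kernelPoly ρ a c (2 * n)).eval (q - x) = (kernelPoly ρ a c (2 * n)).eval x at he
  have h2 := congrArg (eval x) (darboux_relations ρ a c h0 (2 * n + 1)).2
  simp only [eval_sub, eval_mul, eval_X, eval_C, hV] at h2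
  rw [(darboux_relations ρ a c h0 (2 * n)).1] at h2 ⊢
  simp only [eval_sub, eval_mul, eval_X, eval_C, hV, he, hVx] at h2 ⊢
  linear_combination (2 * x - q) * h2

lemma darboux_reflection_even (h0 : c 0 = 0)
    (hβ : ∀ n, ρ - a n - c (n + 1) = if Even n then κ else q - κ) (n : ℕ) (x : ℝ) :
    (x - ρ) * (x - κ) * ((darboux ρ a c (2 * n + 2)).eval x
        - (darboux ρ a c (2 * n + 2)).eval (q - x))
      = -c (2 * n + 2) * (2 * x - q) * ((darboux ρ a c (2 * n + 2)).eval x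
        - a (2 * n + 1) * (darboux ρ a c (2 * n + 1)).eval x) := by
  obtain ⟨-, V, hV, hVx⟩ := monicRec_reflection (u := fun n => c n * a n) hβ n
  obtain ⟨he, -⟩ := monicRec_reflection (u := fun n => c n * a n) hβ (n + 1)
  change kernelPoly ρ a c (2 * n + 1) = _ at hV
  change ∀ x, (kernelPoly ρ a c (2 * n + 2)).eval (q - x)
    = (kernelPoly ρ a c (2 * n + 2)).eval x at he
  have h2 := congrArg (eval x) (darboux_relations ρ a c h0 (2 * n + 1)).2
  simp only [eval_sub, eval_mul, eval_X, eval_C, hV] at h2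
  rw [← h2, (darboux_relations ρ a c h0 (2 * n + 1)).1]
  simp only [eval_sub, eval_mul, eval_X, eval_C, hV, he, hVx]
  ring

/-- If `a_{2n+1} = 0`, then `ρ` and `κ` are roots in degree `2n+2`, the other roots are permuted by
the reflection, and the polynomial of degree `2n+1` takes equal values at exchanged roots. -/
lemma darboux_reflection_roots (h0 : c 0 = 0)
    (hβ : ∀ n, ρ - a n - c (n + 1) = if Even n then κ else q - κ) {n : ℕ}
    (ha : a (2 * n + 1) = 0) :
    (darboux ρ a c (2 * n + 2)).eval ρ = 0 ∧
    ∀ x, (darboux ρ a c (2 * n + 2)).eval x = 0 → x ≠ ρ → x ≠ κ →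
      (darboux ρ a c (2 * n + 2)).eval (q - x) = 0 ∧
        (darboux ρ a c (2 * n + 1)).eval (q - x) = (darboux ρ a c (2 * n + 1)).eval x := by
  have h := (darboux_relations ρ a c h0 (2 * n + 1)).2
  rw [ha, C_0, zero_mul, sub_zero] at h
  refine ⟨by simp [← h], fun x hx h1 h2 => ?_⟩
  have hne : (x - ρ) * (x - κ) ≠ 0 := mul_ne_zero (sub_ne_zero.2 h1) (sub_ne_zero.2 h2)
  have ho := darboux_reflection_odd h0 hβ n x
  have he := darboux_reflection_even h0 hβ n x
  rw [hx, ha, zero_mul, sub_zero, mul_zero] at ho he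
  have ho' := (mul_eq_zero.1 ho).resolve_left hne
  have he' := (mul_eq_zero.1 he).resolve_left hne
  exact ⟨by linarith, by linarith⟩

end Reflection

/-! ### Identities between the recurrence coefficients -/

section Coefficients

variable {j : ℕ} (a b α : ℝ) {n : ℕ}

lemma cast_sub_ne_zero_of_even (hj : Odd j) (hn : Even n) : (n : ℝ) - j ≠ 0 :=
  sub_ne_zero.2 fun h => (Nat.not_even_iff_odd.2 hj) (Nat.cast_injective h ▸ hn)

lemma A3_even (hn : Even n) : A3 j a b α n = 1 / 4 * ((n - j + a) * (n - j + b) / (n - j)) :=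
  if_pos hn

lemma A3_odd (hn : ¬Even n) (hne : n ≠ j) : A3 j a b α n = 1 / 4 * (n - 2 * j - 1) := by
  rw [A3, if_neg hn, if_neg hne]

lemma A3_self (hj : Odd j) : A3 j a b α j = -(1 / 2) * α * (j + 1) := by
  rw [A3, if_neg (Nat.not_even_iff_odd.2 hj), if_pos rfl]

lemma C3_odd (hn : ¬Even n) :
    C3 j a b α n = -(1 / 4) * ((n - j - 1 - a) * (n - j - 1 - b) / (n - j - 1)) :=
  if_neg hn

lemma C3_even (hn : Even n) (hne : n ≠ j + 1) : C3 j a b α n = -(1 / 4) * n := by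
  rw [C3, if_pos hn, if_neg hne]

lemma C3_self (hj : Odd j) : C3 j a b α (j + 1) = -(1 / 2) * (1 - α) * (j + 1) := by
  rw [C3, if_pos (by simpa [parity_simps] using hj), if_pos rfl]

lemma C3_even_add_one (hn : Even n) :
    C3 j a b α (n + 1) = -(1 / 4) * ((n - j - a) * (n - j - b) / (n - j)) := by
  rw [C3_odd a b α (by simpa [parity_simps] using hn)]
  push_cast
  rw [show (n : ℝ) + 1 - j - 1 = n - j by ring]

lemma C3_odd_add_one (hn : ¬Even n) (hne : n ≠ j) : C3 j a b α (n + 1) = -(1 / 4) * (n + 1) := by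
  rw [C3_even a b α (by simpa [parity_simps] using hn) (by omega)]
  push_cast
  rfl

lemma C3_zero : C3 j a b α 0 = 0 := by simp [C3]

lemma A3_last : A3 j a b α (2 * j + 1) = 0 := by
  rw [A3_odd a b α (by simp [parity_simps]) (by omega)]
  push_cast
  ring

lemma A2_eq (hj : Odd j) (n : ℕ) : A2 j a b α n = C3 j a b α (n + 1) := by
  by_cases hn : Even n
  · rw [C3_even_add_one a b α hn, A2, if_pos hn]
  · rcases eq_or_ne n j with rfl | hne
    · rw [C3_self a b α hj, A2, if_neg hn, if_pos rfl]
    · rw [C3_odd_add_one a b α hn hne, A2, if_neg hn, if_neg hne]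

lemma C2_eq (n : ℕ) : C2 j a b α n = A3 j a b α n := rfl

lemma P3_eq_darboux (n : ℕ) :
    P3 j a b α n = darboux ((b - j - 1 + a) / 4) (A3 j a b α) (C3 j a b α) n := rfl

lemma P2_eq_kernelPoly (hj : Odd j) (n : ℕ) :
    P2 j a b α n = kernelPoly ((b - j - 1 + a) / 4) (A3 j a b α) (C3 j a b α) n := by
  refine monicRec_congr (fun n => ?_) (fun n => ?_) n
  · simp only [A2_eq a b α hj, C2_eq]; ring
  · simp only [A2_eq a b α hj, C2_eq, Nat.add_sub_cancel]

/-- The hidden symmetry of the coefficients. For even $n$ the pole $n-j$ cancels in the sum; for odd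
$n$ the sum is always $-\frac{j+1}2$, since at $n=j$ the parts with $\alpha$ and $1-\alpha$ add up
to the generic value. The form `0 - _` matches a reflection with $q=0$. -/
lemma rho_sub_A3_sub_C3 (hj : Odd j) (n : ℕ) :
    (b - j - 1 + a) / 4 - A3 j a b α n - C3 j a b α (n + 1)
      = if Even n then -((a + b + j + 1) / 4) else 0 - -((a + b + j + 1) / 4) := by
  by_cases hn : Even n
  · have h0 := cast_sub_ne_zero_of_even hj hn
    rw [if_pos hn, A3_even a b α hn, C3_even_add_one a b α hn]
    field_simp
    ring
  · rw [if_neg hn]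
    rcases eq_or_ne n j with rfl | hne
    · rw [A3_self a b α hj, C3_self a b α hj]; ring
    · rw [A3_odd a b α hn hne, C3_odd_add_one a b α hn hne]; ring

/-- The same alternation for the second factorization, where the reflection is $x\mapsto-1-x$. -/
lemma rho_sub_A3_sub_C3_dual (hj : Odd j) (n : ℕ) :
    (b - a + j - 1) / 4 - -A3 j a (-b) (1 - α) n - -C3 j a (-b) (1 - α) (n + 1)
      = if Even n then (a - b + j - 1) / 4 else -1 - (a - b + j - 1) / 4 := by
  have h := rho_sub_A3_sub_C3 a (-b) (1 - α) hj n
  split_ifs at h ⊢ <;> linarith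

lemma u3_odd (hj : Odd j) (hn : Even n) :
    u3 j a b α (n + 1)
      = -(((n - j) ^ 2 - a ^ 2) * ((n - j) ^ 2 - b ^ 2) / (16 * (n - j : ℝ) ^ 2)) := by
  have h0 := cast_sub_ne_zero_of_even hj hn
  rw [u3, Nat.add_sub_cancel, A3_even a b α hn, C3_even_add_one a b α hn]
  field_simp
  ring

lemma u3_even (hn : ¬Even n) (hne : n ≠ j) :
    u3 j a b α (n + 1) = (n + 1) * (2 * j + 1 - n) / 16 := by
  rw [u3, Nat.add_sub_cancel, A3_odd a b α hn hne, C3_odd_add_one a b α hn hne]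
  ring

lemma u3_self (hj : Odd j) : u3 j a b α (j + 1) = α * (1 - α) * (j + 1) ^ 2 / 4 := by
  rw [u3, Nat.add_sub_cancel, A3_self a b α hj, C3_self a b α hj]
  ring

/-- These sums of dual coefficients match the two diagonals, and two of them supply the eigenvalues
of the Dunkl operator. -/
lemma C3_add_C3_dual_even (hj : Odd j) (hn : Even n) :
    C3 j a b α n + C3 j a (-b) (1 - α) n = -(n / 2) := by
  rcases eq_or_ne n (j + 1) with rfl | hne
  · rw [C3_self a b α hj, C3_self a _ _ hj]; push_cast; ring
  · rw [C3_even a b α hn hne, C3_even a _ _ hn hne]; ring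

lemma C3_add_C3_dual_odd (hj : Odd j) (hn : ¬Even n) :
    C3 j a b α n + C3 j a (-b) (1 - α) n = -((n - j - 1 - a) / 2) := by
  have h1 : (n : ℝ) - j - 1 ≠ 0 := by
    obtain ⟨m, rfl⟩ := Nat.not_even_iff_odd.1 hn
    have := cast_sub_ne_zero_of_even hj (n := 2 * m) (by simp)
    push_cast
    intro h
    exact this (by push_cast; linarith)
  rw [C3_odd a b α hn, C3_odd a _ _ hn]
  field_simp
  ring

lemma A3_add_A3_dual_even (hj : Odd j) (hn : Even n) :
    A3 j a b α n + A3 j a (-b) (1 - α) n = (n - j + a) / 2 := by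
  have h0 := cast_sub_ne_zero_of_even hj hn
  rw [A3_even a b α hn, A3_even a _ _ hn]
  field_simp
  ring

lemma A3_add_A3_dual_odd (hj : Odd j) (hn : ¬Even n) :
    A3 j a b α n + A3 j a (-b) (1 - α) n = (n - 2 * j - 1) / 2 := by
  rcases eq_or_ne n j with rfl | hne
  · rw [A3_self a b α hj, A3_self a _ _ hj]; ring
  · rw [A3_odd a b α hn hne, A3_odd a _ _ hn hne]; ring

lemma u3_dual (hj : Odd j) (n : ℕ) : u3 j a (-b) (1 - α) (n + 1) = u3 j a b α (n + 1) := by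
  by_cases hn : Even n
  · rw [u3_odd a b α hj hn, u3_odd a _ _ hj hn, neg_sq]
  · rcases eq_or_ne n j with rfl | hne
    · rw [u3_self a b α hj, u3_self a _ _ hj]; ring
    · rw [u3_even a b α hn hne, u3_even a _ _ hn hne]

/-- The product $A_{n-1}C_n$ is unaffected by the two sign changes and depends on $b^2$ and
$\alpha(1-\alpha)$ only; the diagonals agree by the sums above. -/
lemma P3_eq_darboux_dual (hj : Odd j) (n : ℕ) :
    P3 j a b α n = darboux ((b - a + j - 1) / 4) (fun n => -A3 j a (-b) (1 - α) n)
      (fun n => -C3 j a (-b) (1 - α) n) n := by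
  refine monicRec_congr (fun n => ?_) (fun n => ?_) n
  · by_cases hn : Even n
    · linarith [A3_add_A3_dual_even a b α hj hn, C3_add_C3_dual_even a b α hj hn]
    · linarith [A3_add_A3_dual_odd a b α hj hn, C3_add_C3_dual_odd a b α hj hn]
  · rw [neg_mul_neg]
    exact (u3_dual a b α hj n).symm

/-- Transposition of the Jacobi matrix in its antidiagonal. As $2j+1$ is odd, parities are exchanged
and the exceptional indices $j$ and $j+1$ correspond. -/
lemma A3_reflect (hj : Odd j) (hn : n ≤ 2 * j + 1) :
    A3 j a b (1 - α) (2 * j + 1 - n) = C3 j a b α n := by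
  have hc : ((2 * j + 1 - n : ℕ) : ℝ) = 2 * j + 1 - n := by push_cast [Nat.cast_sub hn]; rfl
  by_cases he : Even n
  · have ho : ¬Even (2 * j + 1 - n) := by
      rw [Nat.even_sub hn]; simp [parity_simps, he]
    rcases eq_or_ne n (j + 1) with rfl | hne
    · rw [show 2 * j + 1 - (j + 1) = j by omega, A3_self a b _ hj, C3_self a b _ hj]
    · rw [A3_odd a b _ ho (by omega), C3_even a b _ he hne, hc]; ring
  · have ho : Even (2 * j + 1 - n) := by
      rw [Nat.even_sub hn]; simp [parity_simps, he]
    have h0 := cast_sub_ne_zero_of_even hj ho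
    rw [A3_even a b _ ho, C3_odd a b _ he]
    rw [hc] at h0 ⊢
    have h1 : (n : ℝ) - j - 1 ≠ 0 := fun h => h0 (by linarith)
    field_simp
    ring

lemma C3_reflect (hj : Odd j) (hn : n ≤ 2 * j + 1) :
    C3 j a b (1 - α) (2 * j + 1 - n) = A3 j a b α n := by
  have h := A3_reflect a b (1 - α) hj (Nat.sub_le (2 * j + 1) n)
  rw [sub_sub_cancel, Nat.sub_sub_self hn] at h
  exact h.symm

end Coefficients

/-! ### Truncation limit -/

section Truncation

variable {j : ℕ} {a b α : ℝ} {e₁ e₂ ρ₁ r₁ : ℝ} {ρ₂ r₂ : ℝ → ℝ}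

lemma tendsto_add_mul (l : Filter ℝ) (hl : l ≤ 𝓝 0) (c d : ℝ) :
    Tendsto (fun t => c + d * t) l (𝓝 c) := by
  have h : Continuous fun t : ℝ => c + d * t := by fun_prop
  simpa using (h.tendsto 0).mono_left hl

/-- The limit of the indeterminate coefficient: numerator and denominator both vanish at `0`. -/
lemma tendsto_mul_div_cancel {c d e : ℝ} (he : e ≠ 0) (f : ℝ) :
    Tendsto (fun t : ℝ => (c + d * t) * (f * t) / (e * t)) (𝓝[≠] 0) (𝓝 (c * f / e)) := by
  refine (((tendsto_add_mul _ nhdsWithin_le_nhds c d).mul_const f).div_const e).congr' ?_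
  filter_upwards [self_mem_nhdsWithin] with t ht
  have ht : t ≠ 0 := ht
  field_simp

/-- The denominator is $4(n-j+(e_1+e_2)t)$, so only $n=j$ is indeterminate. -/
lemma tendsto_genC (hj : Odd j) (he : e₁ + e₂ ≠ 0) (hα : e₁ / (e₁ + e₂) = α)
    (hρ₁ : ρ₁ = (b - j - 1 + a) / 4) (hr₁ : -r₁ = (b - j - 1 - a) / 4)
    (hρ₂ : ∀ t, ρ₁ + ρ₂ t = -((j + 1) / 2) + e₁ * t)
    (hr₂ : ∀ t, -r₁ - r₂ t = -((j + 1) / 2) + e₂ * t) (n : ℕ) :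
    Tendsto (fun t => genC ρ₁ (ρ₂ t) r₁ (r₂ t) n) (𝓝[≠] 0) (𝓝 (A3 j a b α n)) := by
  have hρ₂' : ∀ t, ρ₂ t = -((j + 1) / 2) + e₁ * t - ρ₁ := fun t => by linarith [hρ₂ t]
  have hr₂' : ∀ t, r₂ t = (j + 1) / 2 - e₂ * t - r₁ := fun t => by linarith [hr₂ t]
  have T := tendsto_add_mul (𝓝[≠] 0) nhdsWithin_le_nhds
  unfold genC
  by_cases hn : Even n
  · have h0 := cast_sub_ne_zero_of_even hj hn
    simp only [if_pos hn]
    have h := ((T (n - j + a) (2 * e₂)).const_mul (n - j + b)).div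
      (T (4 * (n - j)) (4 * (e₁ + e₂))) (mul_ne_zero four_ne_zero h0)
    rw [A3_even a b α hn]
    convert h using 2 with t
    · rw [hρ₂', hr₂']
      congr 1
      · congr 1 <;> linarith
      · ring
    · field_simp
  · simp only [if_neg hn]
    rcases eq_or_ne n j with rfl | hne
    -- At $n=j$ the factor $n+2\rho_1+2\rho_2+1$ is exactly $2e_1t$, and
    -- $n+2g+1=-(j+1)+2(e_1+e_2)t$.
    · have h := tendsto_mul_div_cancel (c := -(n + 1)) (d := 2 * (e₁ + e₂)) (e := 4 * (e₁ + e₂))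
        (mul_ne_zero four_ne_zero he) (2 * e₁)
      rw [A3_self a b α hj, ← hα]
      convert h using 2 with t
      · rw [hρ₂', hr₂']
        congr 1 <;> ring
      · field_simp
        ring
    · have h0 : (n : ℝ) - j ≠ 0 := sub_ne_zero.2 (Nat.cast_injective.ne hne)
      have h := ((T (n - 2 * j - 1) (2 * (e₁ + e₂))).mul (T (n - j) (2 * e₁))).div
        (T (4 * (n - j)) (4 * (e₁ + e₂))) (mul_ne_zero four_ne_zero h0)
      rw [A3_odd a b α hn hne]
      convert h using 2 with t
      · rw [hρ₂', hr₂']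
        congr 1 <;> ring
      · field_simp

lemma tendsto_genA (hj : Odd j) (he : e₁ + e₂ ≠ 0) (hα : e₁ / (e₁ + e₂) = α)
    (hρ₁ : ρ₁ = (b - j - 1 + a) / 4) (hr₁ : -r₁ = (b - j - 1 - a) / 4)
    (hρ₂ : ∀ t, ρ₁ + ρ₂ t = -((j + 1) / 2) + e₁ * t)
    (hr₂ : ∀ t, -r₁ - r₂ t = -((j + 1) / 2) + e₂ * t) (n : ℕ) :
    Tendsto (fun t => genA ρ₁ (ρ₂ t) r₁ (r₂ t) n) (𝓝[≠] 0) (𝓝 (C3 j a b α (n + 1))) := by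
  have hρ₂' : ∀ t, ρ₂ t = -((j + 1) / 2) + e₁ * t - ρ₁ := fun t => by linarith [hρ₂ t]
  have hr₂' : ∀ t, r₂ t = (j + 1) / 2 - e₂ * t - r₁ := fun t => by linarith [hr₂ t]
  have T := tendsto_add_mul (𝓝[≠] 0) nhdsWithin_le_nhds
  unfold genA
  by_cases hn : Even n
  · have h0 := cast_sub_ne_zero_of_even hj hn
    simp only [if_pos hn]
    have h := (((T (n - j - b) (2 * (e₁ + e₂))).mul (T (n - j - a) (2 * e₁))).div
      (T (4 * (n - j)) (4 * (e₁ + e₂))) (mul_ne_zero four_ne_zero h0)).neg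
    rw [C3_even_add_one a b α hn]
    convert h using 2 with t
    · rw [hρ₂', hr₂']
      congr 2
      · congr 1 <;> linarith
      · ring
    · field_simp
  · simp only [if_neg hn]
    rcases eq_or_ne n j with rfl | hne
    -- Here the vanishing numerator factor is $n-2r_1-2r_2+1=2e_2t$, whence
    -- $1-\alpha=e_2/(e_1+e_2)$.
    · have h := (tendsto_mul_div_cancel (c := n + 1) (d := 0) (e := 4 * (e₁ + e₂))
        (mul_ne_zero four_ne_zero he) (2 * e₂)).neg
      rw [C3_self a b α hj, ← hα]
      convert h using 2 with t
      · rw [hρ₂', hr₂']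
        congr 2 <;> ring
      · field_simp
        ring
    · have h0 : (n : ℝ) - j ≠ 0 := sub_ne_zero.2 (Nat.cast_injective.ne hne)
      have h := (((T (n - j) (2 * e₂)).const_mul ((n : ℝ) + 1)).div
        (T (4 * (n - j)) (4 * (e₁ + e₂))) (mul_ne_zero four_ne_zero h0)).neg
      rw [C3_odd_add_one a b α hn hne]
      convert h using 2 with t
      · rw [hρ₂', hr₂']
        congr 2 <;> ring
      · field_simp

/-- The complementary polynomials tend to $\mathbf P^{(2)}$, and the relation defining $\mathbf B_n$
becomes the Geronimus relation expressing $\mathbf P^{(3)}$ through $\mathbf P^{(2)}$. -/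
lemma tendsto_eval_genB (hj : Odd j) (he : e₁ + e₂ ≠ 0) (hα : e₁ / (e₁ + e₂) = α)
    (hρ₁ : ρ₁ = (b - j - 1 + a) / 4) (hr₁ : -r₁ = (b - j - 1 - a) / 4)
    (hρ₂ : ∀ t, ρ₁ + ρ₂ t = -((j + 1) / 2) + e₁ * t)
    (hr₂ : ∀ t, -r₁ - r₂ t = -((j + 1) / 2) + e₂ * t) (n : ℕ) (x : ℝ) :
    Tendsto (fun t => (genB ρ₁ (ρ₂ t) r₁ (r₂ t) n).eval x) (𝓝[≠] 0)
      (𝓝 ((P3 j a b α n).eval x)) := by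
  have hA := tendsto_genA hj he hα hρ₁ hr₁ hρ₂ hr₂
  have hC := tendsto_genC hj he hα hρ₁ hr₁ hρ₂ hr₂
  have hI : ∀ n, Tendsto (fun t => (genI ρ₁ (ρ₂ t) r₁ (r₂ t) n).eval x) (𝓝[≠] 0)
      (𝓝 ((P2 j a b α n).eval x)) := fun n => by
    rw [P2_eq_kernelPoly a b α hj, ← hρ₁]
    refine tendsto_eval_monicRec (fun n => ?_) (fun n => (hA n).mul (hC (n + 1))) x n
    convert (tendsto_const_nhds.sub (hA n)).sub (hC n) using 2
    ring
  cases n with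
  | zero => simp [genB, genI, P3, monicRec]
  | succ n =>
    rw [P3_eq_darboux, (darboux_relations _ _ _ (C3_zero a b α) n).1, ← P2_eq_kernelPoly a b α hj,
      ← P2_eq_kernelPoly a b α hj]
    simp only [genB, eval_sub, eval_mul, eval_C]
    exact (hI (n + 1)).sub ((hA n).mul (hI n))

end Truncation

/-! ### Dunkl-difference equation -/

section Dunkl

variable {j : ℕ} (a b α : ℝ)

/-- $F=(x-\rho)(x-\kappa)/(2x)$, so applying $F$ is dividing a reflection identity by $2x$; likewise
$G$ belongs to the dual identity and $2x+1$. -/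
lemma dunklF_mul {x : ℝ} (hx : x ≠ 0) {d r : ℝ}
    (h : (x - (b - j - 1 + a) / 4) * (x - -((a + b + j + 1) / 4)) * d = (2 * x - 0) * r) :
    dunklF j a b x * d = r := by
  rw [dunklF, div_mul_eq_mul_div, div_eq_iff (by positivity)]
  linear_combination 16 * h

lemma dunklG_mul {x : ℝ} (hx : x ≠ -(1 / 2)) {d r : ℝ}
    (h : (x - (b - a + j - 1) / 4) * (x - (a - b + j - 1) / 4) * d = (2 * x - -1) * r) :
    dunklG j a b x * -d = -r := by
  have h0 : 2 * x + 1 ≠ 0 := fun h => hx (by linarith)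
  rw [dunklG, div_mul_eq_mul_div, div_eq_iff (mul_ne_zero (by norm_num) h0)]
  linear_combination -16 * h

lemma dunklL_apply (f : ℝ → ℝ) (x : ℝ) : dunklL j a b f x
    = dunklF j a b x * (f x - f (0 - x)) + dunklG j a b x * -(f x - f (-1 - x)) := by
  simp only [dunklL, shiftT, reflR, zero_sub, neg_sub]
  rw [show -(x + 1) = -1 - x by ring]

/-- The two identities contribute $P_{2n+2}$ with opposite signs, leaving minus the sum of the dual
coefficients $A_{2n+1}$ as eigenvalue. -/
lemma dunklL_P3_odd (hj : Odd j) (n : ℕ) {x : ℝ} (hx : x ≠ 0) (hx' : x ≠ -(1 / 2)) :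
    dunklL j a b (fun y => (P3 j a b α (2 * n + 1)).eval y) x
      = (j - n) * (P3 j a b α (2 * n + 1)).eval x := by
  have h1 := darboux_reflection_odd (C3_zero a b α) (rho_sub_A3_sub_C3 a b α hj) n x
  have h2 := darboux_reflection_odd (c := fun n => -C3 j a (-b) (1 - α) n)
    (by simp [C3_zero]) (rho_sub_A3_sub_C3_dual a b α hj) n x
  simp only [← P3_eq_darboux, ← P3_eq_darboux_dual a b α hj] at h1 h2
  rw [dunklL_apply, dunklF_mul a b hx h1, dunklG_mul a b hx' h2]
  have h3 := A3_add_A3_dual_odd a b α hj (n := 2 * n + 1) (by simp [parity_simps])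
  push_cast at h3
  linear_combination -(P3 j a b α (2 * n + 1)).eval x * h3

lemma dunklL_P3_even (hj : Odd j) (n : ℕ) {x : ℝ} (hx : x ≠ 0) (hx' : x ≠ -(1 / 2)) :
    dunklL j a b (fun y => (P3 j a b α (2 * n)).eval y) x = n * (P3 j a b α (2 * n)).eval x := by
  cases n with
  | zero => simp [dunklL_apply, P3, monicRec]
  | succ n =>
    have h1 := darboux_reflection_even (C3_zero a b α) (rho_sub_A3_sub_C3 a b α hj) n x
    have h2 := darboux_reflection_even (c := fun n => -C3 j a (-b) (1 - α) n)
      (by simp [C3_zero]) (rho_sub_A3_sub_C3_dual a b α hj) n x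
    simp only [← P3_eq_darboux, ← P3_eq_darboux_dual a b α hj] at h1 h2
    rw [mul_comm (-_) (2 * x - _), mul_assoc (2 * x - _)] at h1 h2
    rw [dunklL_apply, mul_add, mul_one, dunklF_mul a b hx h1, dunklG_mul a b hx' h2]
    have h3 := C3_add_C3_dual_even a b α hj (n := 2 * n + 2) (by simp [parity_simps])
    -- Equality of the off-diagonal products removes $P_{2n+1}$.
    have h4 : A3 j a (-b) (1 - α) (2 * n + 1) * C3 j a (-b) (1 - α) (2 * n + 2)
      = A3 j a b α (2 * n + 1) * C3 j a b α (2 * n + 2) := u3_dual a b α hj (2 * n + 1)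
    push_cast at h3 ⊢
    linear_combination -(P3 j a b α (2 * n + 2)).eval x * h3
      - (P3 j a b α (2 * n + 1)).eval x * h4

end Dunkl

/-! ### Positivity -/

section Positivity

variable {j : ℕ} {a b α : ℝ}

lemma sq_cast_sub_le {n : ℕ} (hn : n ≤ 2 * j) : ((n : ℝ) - j) ^ 2 ≤ (j : ℝ) ^ 2 := by
  have h : (n : ℝ) ≤ 2 * j := by exact_mod_cast hn
  have : (0 : ℝ) ≤ n := Nat.cast_nonneg n
  nlinarith

lemma one_le_sq_cast_sub {n : ℕ} (hj : Odd j) (hn : Even n) : 1 ≤ ((n : ℝ) - j) ^ 2 := by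
  have h : (n : ℤ) - j ≠ 0 := by
    intro h
    have : (n : ℤ) = j := by omega
    exact (Nat.not_even_iff_odd.2 hj) ((Nat.cast_injective this : n = j) ▸ hn)
  have h1 : 1 ≤ ((n : ℤ) - j) ^ 2 := Int.add_one_le_iff.2 (even_two.pow_pos h)
  exact_mod_cast h1

lemma mul_sq_sub_neg (h : (j < |a| ∧ |b| < 1) ∨ (|a| < 1 ∧ j < |b|)) {m : ℝ}
    (h1 : 1 ≤ m ^ 2) (h2 : m ^ 2 ≤ (j : ℝ) ^ 2) : (m ^ 2 - a ^ 2) * (m ^ 2 - b ^ 2) < 0 := by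
  have hj0 : (0 : ℝ) ≤ j := Nat.cast_nonneg j
  rcases h with ⟨ha, hb⟩ | ⟨ha, hb⟩
  · have ha' : (j : ℝ) ^ 2 < a ^ 2 := by rw [← sq_abs a]; gcongr
    have hb' : b ^ 2 < 1 := (sq_lt_one_iff_abs_lt_one b).2 hb
    exact mul_neg_of_neg_of_pos (by linarith) (by linarith)
  · have hb' : (j : ℝ) ^ 2 < b ^ 2 := by rw [← sq_abs b]; gcongr
    have ha' : a ^ 2 < 1 := (sq_lt_one_iff_abs_lt_one a).2 ha
    exact mul_neg_of_pos_of_neg (by linarith) (by linarith)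

lemma mul_sq_sub_nonpos (h : (j ≤ |a| ∧ |b| ≤ 1) ∨ (|a| ≤ 1 ∧ j ≤ |b|)) {m : ℝ}
    (h1 : 1 ≤ m ^ 2) (h2 : m ^ 2 ≤ (j : ℝ) ^ 2) : (m ^ 2 - a ^ 2) * (m ^ 2 - b ^ 2) ≤ 0 := by
  have hj0 : (0 : ℝ) ≤ j := Nat.cast_nonneg j
  rcases h with ⟨ha, hb⟩ | ⟨ha, hb⟩
  · have ha' : (j : ℝ) ^ 2 ≤ a ^ 2 := by rw [← sq_abs a]; gcongr
    have hb' : b ^ 2 ≤ 1 := (sq_le_one_iff_abs_le_one b).2 hb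
    exact mul_nonpos_of_nonpos_of_nonneg (by linarith) (by linarith)
  · have hb' : (j : ℝ) ^ 2 ≤ b ^ 2 := by rw [← sq_abs b]; gcongr
    have ha' : a ^ 2 ≤ 1 := (sq_le_one_iff_abs_le_one a).2 ha
    exact mul_nonpos_of_nonneg_of_nonpos (by linarith) (by linarith)

lemma u3_even_pos {n : ℕ} (hn : n ≤ 2 * j) : 0 < ((n : ℝ) + 1) * (2 * j + 1 - n) / 16 := by
  have h : (n : ℝ) ≤ 2 * j := by exact_mod_cast hn
  have h' : 0 < 2 * (j : ℝ) + 1 - n := by linarith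
  positivity

/-- At odd indices the sign is that of $-(m^2-a^2)(m^2-b^2)$ with $m=n-j$ odd, $1\le m^2\le j^2$.
The extreme cases $m=1$ and $m=-j$ already force $a^2,b^2$ to lie outside $[1,j^2]$ on opposite
sides; the index $j+1$ accounts for $\alpha$. -/
lemma u3_pos_iff (hj : Odd j) : (∀ n ∈ Finset.Icc 1 (2 * j + 1), 0 < u3 j a b α n) ↔
    ((j < |a| ∧ |b| < 1) ∨ (|a| < 1 ∧ j < |b|)) ∧ 0 < α ∧ α < 1 := by
  have hjpos := hj.pos
  have hj1 : (1 : ℝ) ≤ j := by exact_mod_cast hjpos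
  have hiff : ∀ {n : ℕ}, Even n → (0 < u3 j a b α (n + 1) ↔
      (((n : ℝ) - j) ^ 2 - a ^ 2) * (((n : ℝ) - j) ^ 2 - b ^ 2) < 0) := fun {n} hn => by
    have := one_le_sq_cast_sub hj hn
    rw [u3_odd a b α hj hn, neg_pos, div_neg_iff]
    constructor
    · rintro (⟨-, h⟩ | ⟨h, -⟩)
      · linarith
      · exact h
    · exact fun h => Or.inr ⟨h, by linarith⟩
  have hself : 0 < u3 j a b α (j + 1) ↔ 0 < α ∧ α < 1 := by
    rw [u3_self a b α hj, show α * (1 - α) * (j + 1 : ℝ) ^ 2 / 4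
      = α * (1 - α) * ((j + 1 : ℝ) ^ 2 / 4) by ring, mul_pos_iff_of_pos_right (by positivity)]
    constructor
    · intro h; constructor <;> nlinarith
    · rintro ⟨h1, h2⟩; nlinarith
  constructor
  · intro h
    refine ⟨?_, hself.1 (h _ (Finset.mem_Icc.2 ⟨by omega, by omega⟩))⟩
    have h1 := (hiff (n := j + 1) (by simpa [parity_simps] using hj)).1
      (h _ (Finset.mem_Icc.2 ⟨by omega, by omega⟩))
    have h2 := (hiff (n := 0) (by simp)).1 (h _ (Finset.mem_Icc.2 ⟨by omega, by omega⟩))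
    push_cast at h1 h2
    rw [add_sub_cancel_left, one_pow, mul_neg_iff] at h1
    rw [zero_sub, neg_sq, mul_neg_iff] at h2
    have hjj : (1 : ℝ) ≤ (j : ℝ) ^ 2 := by nlinarith
    rcases h1 with ⟨ha, hb⟩ | ⟨ha, hb⟩
    · refine Or.inr ⟨(sq_lt_one_iff_abs_lt_one a).1 (by linarith), ?_⟩
      rcases h2 with ⟨-, h⟩ | ⟨h, -⟩
      · exact lt_of_pow_lt_pow_left₀ 2 (abs_nonneg b) (by rw [sq_abs]; linarith)
      · linarith
    · refine Or.inl ⟨?_, (sq_lt_one_iff_abs_lt_one b).1 (by linarith)⟩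
      rcases h2 with ⟨-, h⟩ | ⟨h, -⟩
      · linarith
      · exact lt_of_pow_lt_pow_left₀ 2 (abs_nonneg a) (by rw [sq_abs]; linarith)
  · rintro ⟨hab, hα⟩ n hn
    obtain ⟨h1, h2⟩ := Finset.mem_Icc.1 hn
    obtain ⟨n, rfl⟩ := Nat.exists_eq_add_of_le' h1
    by_cases he : Even n
    · exact (hiff he).2 (mul_sq_sub_neg hab (one_le_sq_cast_sub hj he) (sq_cast_sub_le (by omega)))
    · rcases eq_or_ne n j with rfl | hne
      · exact hself.2 hα
      · rw [u3_even a b α he hne]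
        exact u3_even_pos (by omega)

lemma u3_nonneg (hj : Odd j) (hab : (j ≤ |a| ∧ |b| ≤ 1) ∨ (|a| ≤ 1 ∧ j ≤ |b|)) (h0 : 0 ≤ α)
    (h1 : α ≤ 1) {n : ℕ} (hn : n ∈ Finset.Icc 1 (2 * j + 1)) : 0 ≤ u3 j a b α n := by
  obtain ⟨hn1, hn2⟩ := Finset.mem_Icc.1 hn
  obtain ⟨n, rfl⟩ := Nat.exists_eq_add_of_le' hn1
  by_cases he : Even n
  · rw [u3_odd a b α hj he, neg_nonneg]
    exact div_nonpos_of_nonpos_of_nonneg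
      (mul_sq_sub_nonpos hab (one_le_sq_cast_sub hj he) (sq_cast_sub_le (by omega))) (by positivity)
  · rcases eq_or_ne n j with rfl | hne
    · rw [u3_self a b α hj]
      have : 0 ≤ 1 - α := by linarith
      positivity
    · rw [u3_even a b α he hne]
      exact (u3_even_pos (by omega)).le

end Positivity

/-! ### The squared norms -/

section Norms

variable {j : ℕ} {a b α : ℝ}

lemma poch_succ (x : ℝ) (k : ℕ) : poch x (k + 1) = poch x k * (x + k) :=
  Finset.prod_range_succ _ _

lemma prod_Icc_one_eq_prod_range (f : ℕ → ℝ) (n : ℕ) :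
    ∏ k ∈ Finset.Icc 1 n, f k = ∏ k ∈ Finset.range n, f (k + 1) := by
  induction n with
  | zero => simp
  | succ n ih => rw [Finset.prod_Icc_succ_top (by omega), Finset.prod_range_succ, ih]

variable (j a b) in
/-- The radicand of `h_{2k}`. -/
noncomputable def evenRadicand (k : ℕ) : ℝ :=
  poch (-j) k * poch 1 k * poch (-((j - a) / 2)) k * poch (-((j + a) / 2)) k
    * poch (-((j - b) / 2)) k * poch (-((j + b) / 2)) k

variable (j a b) in
/-- The radicand of `h_{2k+1}`. -/
noncomputable def oddRadicand (k : ℕ) : ℝ :=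
  (-1) * poch (-j) k * poch 1 k * poch (-((j - a) / 2)) (k + 1)
    * poch (-((j + a) / 2)) (k + 1) * poch (-((j - b) / 2)) (k + 1) * poch (-((j + b) / 2)) (k + 1)

lemma poch_neg_half_ne_zero (hj : Odd j) (k : ℕ) : poch (-((j : ℝ) / 2)) k ≠ 0 := by
  refine Finset.prod_ne_zero_iff.2 fun i _ h => ?_
  refine cast_sub_ne_zero_of_even hj (even_two_mul i) ?_
  push_cast
  linarith

lemma prod_u3_odd_step (hj : Odd j) {k : ℕ} {t : ℝ}
    (h : ∏ i ∈ Finset.range (2 * k), u3 j a b α (i + 1)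
      = evenRadicand j a b k / (2 ^ (2 * k) * poch (-(j / 2)) k) ^ 2 * t) :
    ∏ i ∈ Finset.range (2 * k + 1), u3 j a b α (i + 1)
      = oddRadicand j a b k / (2 ^ (2 * k + 1) * poch (-(j / 2)) (k + 1)) ^ 2 * t := by
  have h0 := cast_sub_ne_zero_of_even hj (even_two_mul k)
  have hp := poch_neg_half_ne_zero hj k
  rw [Finset.prod_range_succ, h, u3_odd a b α hj (even_two_mul k)]
  simp only [evenRadicand, oddRadicand, poch_succ]
  push_cast at h0 ⊢
  have h1 : -((j : ℝ) / 2) + k ≠ 0 := fun h => h0 (by linarith)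
  have h2 : 2 * (k : ℝ) - j = 2 * (-((j : ℝ) / 2) + k) := by ring
  rw [h2]
  field_simp
  ring

/-- The exceptional $u_{j+1}$ is $4\alpha(1-\alpha)$ times the generic expression at $n=j$; this is
the origin of $\theta_n$. -/
lemma prod_u3_even_step (hj : Odd j) {k : ℕ} {t s : ℝ}
    (hts : if 2 * k + 1 = j then s = 4 * (α * (1 - α)) * t else s = t)
    (h : ∏ i ∈ Finset.range (2 * k + 1), u3 j a b α (i + 1)
      = oddRadicand j a b k / (2 ^ (2 * k + 1) * poch (-(j / 2)) (k + 1)) ^ 2 * t) :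
    ∏ i ∈ Finset.range (2 * (k + 1)), u3 j a b α (i + 1)
      = evenRadicand j a b (k + 1) / (2 ^ (2 * (k + 1)) * poch (-(j / 2)) (k + 1)) ^ 2 * s := by
  have hp := poch_neg_half_ne_zero hj (k + 1)
  rw [show 2 * (k + 1) = 2 * k + 1 + 1 by ring, Finset.prod_range_succ, h]
  simp only [evenRadicand, oddRadicand, poch_succ (-(j : ℝ)), poch_succ 1]
  generalize poch (-((j : ℝ) / 2)) (k + 1) = p at *
  split_ifs at hts with hk
  · subst hk hts
    rw [u3_self a b α hj]
    push_cast
    field_simp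
    ring
  · subst hts
    rw [u3_even a b α (by simp [parity_simps]) hk]
    push_cast
    field_simp
    ring

variable (j α) in
/-- The square of the factor `θ_n`. -/
noncomputable def thetaSq (k : ℕ) : ℝ := if k < (j + 1) / 2 then 1 else 4 * (α * (1 - α))

lemma prod_u3_even (hj : Odd j) (k : ℕ) :
    ∏ i ∈ Finset.range (2 * k), u3 j a b α (i + 1)
      = evenRadicand j a b k / (2 ^ (2 * k) * poch (-(j / 2)) k) ^ 2 * thetaSq j α k := by
  obtain ⟨M, hM⟩ := hj
  induction k with
  | zero =>
    simp only [thetaSq, if_pos (show 0 < (j + 1) / 2 by omega)]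
    simp [evenRadicand, poch]
  | succ k ih =>
    refine prod_u3_even_step ⟨M, hM⟩ ?_ (prod_u3_odd_step ⟨M, hM⟩ ih)
    simp only [thetaSq]
    split_ifs <;> first | omega | ring

lemma prod_u3_odd (hj : Odd j) (k : ℕ) :
    ∏ i ∈ Finset.range (2 * k + 1), u3 j a b α (i + 1)
      = oddRadicand j a b k / (2 ^ (2 * k + 1) * poch (-(j / 2)) (k + 1)) ^ 2 * thetaSq j α k :=
  prod_u3_odd_step hj (prod_u3_even hj k)

lemma thetaSq_half (k : ℕ) : thetaSq j (1 / 2) k = 1 := by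
  simp only [thetaSq]
  split_ifs <;> norm_num

lemma prod_u3_half_nonneg (hj : Odd j) (hab : (j < |a| ∧ |b| < 1) ∨ (|a| < 1 ∧ j < |b|)) {n : ℕ}
    (hn : n ≤ 2 * j + 1) : 0 ≤ ∏ i ∈ Finset.range n, u3 j a b (1 / 2) (i + 1) := by
  refine Finset.prod_nonneg fun i hi => ?_
  exact ((u3_pos_iff hj).2 ⟨hab, by norm_num, by norm_num⟩ _
    (Finset.mem_Icc.2 ⟨by omega, by have := Finset.mem_range.1 hi; omega⟩)).le

/-- The radicands do not involve $\alpha$, so their nonnegativity is read off at $\alpha=\frac12$,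
where every $u_n$ is positive and $\theta_n=1$. This covers $\alpha=0,1$, where the products may
vanish. -/
lemma norm3_sq (hj : Odd j) (hab : (j < |a| ∧ |b| < 1) ∨ (|a| < 1 ∧ j < |b|)) (h0 : 0 ≤ α)
    (h1 : α ≤ 1) {n : ℕ} (hn : n ≤ 2 * j + 1) :
    norm3 j a b α n ^ 2 = ∏ i ∈ Finset.range n, u3 j a b α (i + 1) := by
  have hα : 0 ≤ α * (1 - α) := mul_nonneg h0 (by linarith)
  have ht : ∀ k, (if k < (j + 1) / 2 then (1 : ℝ) else 2 * √(α * (1 - α))) ^ 2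
      = thetaSq j α k := fun k => by
    simp only [thetaSq]
    split_ifs
    · norm_num
    · rw [mul_pow, Real.sq_sqrt hα]; norm_num
  have hnn := prod_u3_half_nonneg hj hab hn
  obtain ⟨k, rfl | rfl⟩ := n.even_or_odd'
  · have hp := poch_neg_half_ne_zero hj k
    rw [prod_u3_even hj, thetaSq_half, mul_one] at hnn
    have hE : 0 ≤ evenRadicand j a b k := by
      by_contra hneg
      have := div_neg_of_neg_of_pos (not_le.1 hneg)
        (show 0 < (2 ^ (2 * k) * poch (-((j : ℝ) / 2)) k) ^ 2 by positivity)
      linarith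
    rw [prod_u3_even hj, norm3, if_pos (even_two_mul k), Nat.mul_div_cancel_left k two_pos, mul_pow,
      ht, div_pow, mul_pow, sq_abs, ← mul_pow]
    congr 2
    exact Real.sq_sqrt hE
  · have hp := poch_neg_half_ne_zero hj (k + 1)
    rw [prod_u3_odd hj, thetaSq_half, mul_one] at hnn
    have hE : 0 ≤ oddRadicand j a b k := by
      by_contra hneg
      have := div_neg_of_neg_of_pos (not_le.1 hneg)
        (show 0 < (2 ^ (2 * k + 1) * poch (-((j : ℝ) / 2)) (k + 1)) ^ 2 by positivity)
      linarith
    rw [prod_u3_odd hj, norm3, if_neg (by simp [parity_simps]),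
      show (2 * k + 1) / 2 = k by omega, mul_pow, ht, div_pow, mul_pow, sq_abs, ← mul_pow]
    congr 2
    exact Real.sq_sqrt hE

lemma norm3_nonneg (n : ℕ) : 0 ≤ norm3 j a b α n := by
  unfold norm3
  refine mul_nonneg ?_ ?_ <;> split_ifs <;> positivity

end Norms

/-! ### The spectrum -/

section Spectrum

variable {j : ℕ} {a b α : ℝ}

lemma grid_zero (s : ℕ) : grid j a b (4 * s) = (b - a + j - 1) / 4 - s := by
  have h1 : 4 * s / 4 = s := by omega
  have h2 : 4 * s % 4 = 0 := by omega
  simp only [grid, h1, h2, if_true]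
  ring

lemma grid_one (s : ℕ) : grid j a b (4 * s + 1) = s - (a + b + j + 1) / 4 := by
  have h1 : (4 * s + 1) / 4 = s := by omega
  have h2 : (4 * s + 1) % 4 = 1 := by omega
  simp only [grid, h1, h2, if_true, one_ne_zero, if_false]
  ring

lemma grid_two (s : ℕ) : grid j a b (4 * s + 2) = s - (b - a + j - 1) / 4 := by
  have h1 : (4 * s + 2) / 4 = s := by omega
  have h2 : (4 * s + 2) % 4 = 2 := by omega
  simp only [grid, h1, h2]
  norm_num
  ring

lemma grid_three (s : ℕ) : grid j a b (4 * s + 3) = (a + b + j + 1) / 4 - 1 - s := by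
  have h1 : (4 * s + 3) / 4 = s := by omega
  have h2 : (4 * s + 3) % 4 = 3 := by omega
  simp only [grid, h1, h2]
  norm_num
  ring

lemma forall_lt_four_mul_add_four {M : ℕ} {p : ℕ → Prop} (h0 : ∀ s ≤ M, p (4 * s))
    (h1 : ∀ s ≤ M, p (4 * s + 1)) (h2 : ∀ s ≤ M, p (4 * s + 2)) (h3 : ∀ s ≤ M, p (4 * s + 3))
    {i : ℕ} (hi : i < 4 * M + 4) : p i := by
  have hs : i / 4 ≤ M := by omega
  have hr : i % 4 < 4 := Nat.mod_lt _ (by norm_num)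
  rw [← Nat.div_add_mod i 4]
  interval_cases i % 4
  · exact h0 _ hs
  · exact h1 _ hs
  · exact h2 _ hs
  · exact h3 _ hs

lemma ne_odd_intCast {c : ℝ} (hc : j < |c| ∨ |c| < 1) {d : ℤ} (hd : Odd d) (hle : |d| ≤ j) :
    c ≠ d := by
  rintro rfl
  rcases hc with h | h
  · have : (|d| : ℝ) ≤ j := by exact_mod_cast hle
    linarith
  · have h' : |d| < 1 := by exact_mod_cast h
    have : d = 0 := Int.abs_lt_one_iff.1 h'
    subst this
    simp at hd

/-! ### Excluded coincidences between grid points -/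

section Separation

variable {M s t : ℕ} (hab : ((2 * M + 1 : ℕ) < |a| ∧ |b| < 1) ∨ (|a| < 1 ∧ (2 * M + 1 : ℕ) < |b|))
  (hs : s ≤ M) (ht : t ≤ M)

include hab hs ht

/-- $|b-a|\ge\bigl||a|-|b|\bigr|>j-1=2M$, so the left side lies outside $[0,2M]$, where $s+t$ lies.
-/
lemma grid_sep_sub : (b - a) / 2 + M ≠ s + t := by
  have hs' : (s : ℝ) ≤ M := by exact_mod_cast hs
  have ht' : (t : ℝ) ≤ M := by exact_mod_cast ht
  have hs0 : (0 : ℝ) ≤ s := s.cast_nonneg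
  have ht0 : (0 : ℝ) ≤ t := t.cast_nonneg
  push_cast at hab
  intro h
  rcases hab with ⟨h1, h2⟩ | ⟨h1, h2⟩ <;> rcases abs_cases a with ⟨h3, _⟩ | ⟨h3, _⟩ <;>
    rcases abs_cases b with ⟨h4, _⟩ | ⟨h4, _⟩ <;> linarith

lemma grid_sep_add : (a + b) / 2 + M ≠ s + t := by
  have hs' : (s : ℝ) ≤ M := by exact_mod_cast hs
  have ht' : (t : ℝ) ≤ M := by exact_mod_cast ht
  have hs0 : (0 : ℝ) ≤ s := s.cast_nonneg
  have ht0 : (0 : ℝ) ≤ t := t.cast_nonneg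
  push_cast at hab
  intro h
  rcases hab with ⟨h1, h2⟩ | ⟨h1, h2⟩ <;> rcases abs_cases a with ⟨h3, _⟩ | ⟨h3, _⟩ <;>
    rcases abs_cases b with ⟨h4, _⟩ | ⟨h4, _⟩ <;> linarith

lemma grid_sep_right : b ≠ 2 * s + 2 * t - 2 * M - 1 := by
  have h := ne_odd_intCast (j := 2 * M + 1) (c := b) (d := 2 * s + 2 * t - 2 * M - 1)
    (by tauto) ⟨s + t - M - 1, by ring⟩ (by rw [abs_le]; push_cast; omega)
  exact_mod_cast h

lemma grid_sep_right' : b ≠ 2 * s + 2 * t + 1 - 2 * M := by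
  have h := ne_odd_intCast (j := 2 * M + 1) (c := b) (d := 2 * s + 2 * t + 1 - 2 * M)
    (by tauto) ⟨s + t - M, by ring⟩ (by rw [abs_le]; push_cast; omega)
  exact_mod_cast h

lemma grid_sep_left : a ≠ 1 + 2 * s - 2 * t := by
  have h := ne_odd_intCast (j := 2 * M + 1) (c := a) (d := 1 + 2 * s - 2 * t)
    (by tauto) ⟨s - t, by ring⟩ (by rw [abs_le]; push_cast; omega)
  exact_mod_cast h

lemma grid_sep_left' : a ≠ 2 * s - 2 * t - 1 := by
  have h := ne_odd_intCast (j := 2 * M + 1) (c := a) (d := 2 * s - 2 * t - 1)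
    (by tauto) ⟨s - t - 1, by ring⟩ (by rw [abs_le]; push_cast; omega)
  exact_mod_cast h

end Separation

/-- Within a residue class mod 4 the points have slope $\pm1$ in $s$. A coincidence between classes
of equal parity constrains $a\pm b$; otherwise it makes $a$ or $b$ an odd integer in $[-j,j]$. -/
lemma grid_injOn (hj : Odd j) (hab : (j < |a| ∧ |b| < 1) ∨ (|a| < 1 ∧ j < |b|)) :
    Set.InjOn (grid j a b) (Finset.range (2 * j + 2)) := by
  obtain ⟨M, rfl⟩ := hj
  have key : ∀ {i}, i < 4 * M + 4 → ∀ {k}, k < 4 * M + 4 →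
      grid (2 * M + 1) a b i = grid (2 * M + 1) a b k → i = k := by
    intro i hi k hk
    revert hk
    refine forall_lt_four_mul_add_four (p := fun i => k < 4 * M + 4 →
      grid (2 * M + 1) a b i = grid (2 * M + 1) a b k → i = k) ?_ ?_ ?_ ?_ hi <;>
    intro s hs hk <;>
    refine forall_lt_four_mul_add_four (p := fun k =>
      grid (2 * M + 1) a b _ = grid (2 * M + 1) a b k → _ = k) ?_ ?_ ?_ ?_ hk <;>
    intro t ht h <;>
    simp only [grid_zero, grid_one, grid_two, grid_three] at h <;> push_cast at h <;>
    first
    | (have : (s : ℝ) = t := by linarith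
       have := Nat.cast_injective this
       omega)
    | exact absurd (by linarith) (grid_sep_sub hab hs ht)
    | exact absurd (by linarith) (grid_sep_add hab hs ht)
    | exact absurd (by linarith) (grid_sep_right hab hs ht)
    | exact absurd (by linarith) (grid_sep_right' hab hs ht)
    | exact absurd (by linarith) (grid_sep_left hab hs ht)
    | exact absurd (by linarith) (grid_sep_left' hab hs ht)
    | exact absurd (by linarith) (grid_sep_left hab ht hs)
    | exact absurd (by linarith) (grid_sep_left' hab ht hs)
  intro i hi k hk h
  have hi := Finset.mem_range.1 (Finset.mem_coe.1 hi)
  have hk := Finset.mem_range.1 (Finset.mem_coe.1 hk)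
  exact key (by omega) (by omega) h

end Spectrum

/-! ### Roots of $P_{2j+2}$ and the values of $P_{2j+1}$ there -/

section Spectrum

variable {j : ℕ} {a b α : ℝ}

lemma P3_reflection_roots (hj : Odd j) :
    (P3 j a b α (2 * j + 2)).eval ((b - j - 1 + a) / 4) = 0 ∧
    ∀ x, (P3 j a b α (2 * j + 2)).eval x = 0 → x ≠ (b - j - 1 + a) / 4 →
      x ≠ -((a + b + j + 1) / 4) → (P3 j a b α (2 * j + 2)).eval (0 - x) = 0 ∧
        (P3 j a b α (2 * j + 1)).eval (0 - x) = (P3 j a b α (2 * j + 1)).eval x :=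
  darboux_reflection_roots (C3_zero a b α) (rho_sub_A3_sub_C3 a b α hj) (A3_last a b α)

lemma P3_reflection_roots_dual (hj : Odd j) :
    (P3 j a b α (2 * j + 2)).eval ((b - a + j - 1) / 4) = 0 ∧
    ∀ x, (P3 j a b α (2 * j + 2)).eval x = 0 → x ≠ (b - a + j - 1) / 4 →
      x ≠ (a - b + j - 1) / 4 → (P3 j a b α (2 * j + 2)).eval (-1 - x) = 0 ∧
        (P3 j a b α (2 * j + 1)).eval (-1 - x) = (P3 j a b α (2 * j + 1)).eval x := by
  simp only [P3_eq_darboux_dual a b α hj]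
  exact darboux_reflection_roots (by simp [C3_zero]) (rho_sub_A3_sub_C3_dual a b α hj)
    (by simp [A3_last])

variable (j a b α) in
/-- The common value of `P_{2j+1}` at the grid points of odd index. -/
noncomputable def lastValue : ℝ := ∏ i ∈ Finset.range (2 * j + 1), A3 j a b α i

lemma P3_last_eval_rho :
    (P3 j a b α (2 * j + 1)).eval ((b - j - 1 + a) / 4) = lastValue j a b α :=
  eval_darboux_root _ _ _ (C3_zero a b α) _

lemma P3_last_eval_dual (hj : Odd j) :
    (P3 j a b α (2 * j + 1)).eval ((b - a + j - 1) / 4) = -lastValue j a (-b) (1 - α) := by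
  rw [P3_eq_darboux_dual a b α hj, eval_darboux_root _ _ _ (by simp [C3_zero]), Finset.prod_neg,
    Finset.card_range, (odd_two_mul_add_one j).neg_one_pow, neg_one_mul, lastValue]

/-- The grid consists of two chains of roots of `P_{2j+2}`, each generated from one root by applying
the two reflections alternately; `P_{2j+1}` is constant on each chain. -/
lemma P3_eval_grid (hj : Odd j) (hab : (j < |a| ∧ |b| < 1) ∨ (|a| < 1 ∧ j < |b|)) {i : ℕ}
    (hi : i < 2 * j + 2) : (P3 j a b α (2 * j + 2)).eval (grid j a b i) = 0 ∧
      (P3 j a b α (2 * j + 1)).eval (grid j a b i)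
        = if Even i then -lastValue j a (-b) (1 - α) else lastValue j a b α := by
  have hne : ∀ {i k : ℕ}, i < 2 * j + 2 → k < 2 * j + 2 → i ≠ k → grid j a b i ≠ grid j a b k :=
    fun hi hk => (grid_injOn hj hab).ne (by simpa using hi) (by simpa using hk)
  obtain ⟨hroot, hR⟩ := P3_reflection_roots (a := a) (b := b) (α := α) hj
  obtain ⟨hroot', hS⟩ := P3_reflection_roots_dual (a := a) (b := b) (α := α) hj
  have hval := P3_last_eval_rho (j := j) (a := a) (b := b) (α := α)
  have hval' := P3_last_eval_dual (a := a) (b := b) (α := α) hj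
  obtain ⟨M, hM⟩ := hj
  have hMc : (j : ℝ) = 2 * M + 1 := by rw [hM]; push_cast; rfl
  -- The exceptional roots are the ends of the chains: those of $x\mapsto-x$ end the odd-index
  -- chain, those of $x\mapsto-1-x$ the even-index one. By injectivity no other grid point is
  -- exceptional.
  have g0 : (b - a + j - 1) / 4 = grid j a b 0 := by
    rw [show (0 : ℕ) = 4 * 0 by rfl, grid_zero]; simp
  have g1 : -((a + b + j + 1) / 4) = grid j a b 1 := by
    rw [show (1 : ℕ) = 4 * 0 + 1 by rfl, grid_one]; simp
  have g2 : (a - b + j - 1) / 4 = grid j a b (4 * M + 2) := by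
    rw [grid_two]; linarith
  have g3 : (b - j - 1 + a) / 4 = grid j a b (4 * M + 3) := by
    rw [grid_three]; linarith
  rw [g3] at hroot hR hval
  rw [g0] at hroot' hS hval'
  rw [g1] at hR
  rw [g2] at hS
  -- The odd-index chain starts at $\rho=x_{4M+3}$ and descends, hence the induction on $d=M-s$; the
  -- even-index chain `hg` ascends from $x_0$.
  have hf : ∀ d s, s + d = M →
      ((P3 j a b α (2 * j + 2)).eval (grid j a b (4 * s + 3)) = 0 ∧
        (P3 j a b α (2 * j + 1)).eval (grid j a b (4 * s + 3)) = lastValue j a b α) ∧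
      (P3 j a b α (2 * j + 2)).eval (grid j a b (4 * s + 1)) = 0 ∧
        (P3 j a b α (2 * j + 1)).eval (grid j a b (4 * s + 1)) = lastValue j a b α := by
    intro d
    have step : ∀ s ≤ M, ((P3 j a b α (2 * j + 2)).eval (grid j a b (4 * s + 3)) = 0 ∧
        (P3 j a b α (2 * j + 1)).eval (grid j a b (4 * s + 3)) = lastValue j a b α) →
      (P3 j a b α (2 * j + 2)).eval (grid j a b (4 * s + 1)) = 0 ∧
        (P3 j a b α (2 * j + 1)).eval (grid j a b (4 * s + 1)) = lastValue j a b α := by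
      rintro s hs ⟨h1, h2⟩
      have h := hS _ h1 (hne (by omega) (by omega) (by omega)) (hne (by omega) (by omega) (by omega))
      rw [h2, show -1 - grid j a b (4 * s + 3) = grid j a b (4 * s + 1) by
        rw [grid_three, grid_one]; ring] at h
      exact h
    induction d with
    | zero =>
      rintro s rfl
      exact ⟨⟨hroot, hval⟩, step _ le_rfl ⟨hroot, hval⟩⟩
    | succ d ih =>
      intro s hs
      obtain ⟨-, h1, h2⟩ := ih (s + 1) (by omega)
      have h := hR _ h1 (hne (by omega) (by omega) (by omega)) (hne (by omega) (by omega) (by omega))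
      rw [h2, show 0 - grid j a b (4 * (s + 1) + 1) = grid j a b (4 * s + 3) by
        rw [grid_three, grid_one]; push_cast; ring] at h
      exact ⟨h, step s (by omega) h⟩
  have hg : ∀ s ≤ M, ((P3 j a b α (2 * j + 2)).eval (grid j a b (4 * s)) = 0 ∧
        (P3 j a b α (2 * j + 1)).eval (grid j a b (4 * s)) = -lastValue j a (-b) (1 - α)) ∧
      (P3 j a b α (2 * j + 2)).eval (grid j a b (4 * s + 2)) = 0 ∧
        (P3 j a b α (2 * j + 1)).eval (grid j a b (4 * s + 2))
          = -lastValue j a (-b) (1 - α) := by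
    intro s
    have step : ∀ s ≤ M, ((P3 j a b α (2 * j + 2)).eval (grid j a b (4 * s)) = 0 ∧
        (P3 j a b α (2 * j + 1)).eval (grid j a b (4 * s)) = -lastValue j a (-b) (1 - α)) →
      (P3 j a b α (2 * j + 2)).eval (grid j a b (4 * s + 2)) = 0 ∧
        (P3 j a b α (2 * j + 1)).eval (grid j a b (4 * s + 2))
          = -lastValue j a (-b) (1 - α) := by
      rintro s hs ⟨h1, h2⟩
      have h := hR _ h1 (hne (by omega) (by omega) (by omega)) (hne (by omega) (by omega) (by omega))
      rw [h2, show 0 - grid j a b (4 * s) = grid j a b (4 * s + 2) by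
        rw [grid_zero, grid_two]; ring] at h
      exact h
    induction s with
    | zero => exact fun h => ⟨⟨hroot', hval'⟩, step 0 h ⟨hroot', hval'⟩⟩
    | succ s ih =>
      intro hs
      obtain ⟨-, h1, h2⟩ := ih (by omega)
      have h := hS _ h1 (hne (by omega) (by omega) (by omega)) (hne (by omega) (by omega) (by omega))
      rw [h2, show -1 - grid j a b (4 * s + 2) = grid j a b (4 * (s + 1)) by
        rw [grid_zero, grid_two]; push_cast; ring] at h
      exact ⟨h, step _ hs h⟩
  refine forall_lt_four_mul_add_four (M := M) (p := fun i =>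
    (P3 j a b α (2 * j + 2)).eval (grid j a b i) = 0 ∧
      (P3 j a b α (2 * j + 1)).eval (grid j a b i)
        = if Even i then -lastValue j a (-b) (1 - α) else lastValue j a b α)
    (fun s hs => ?_) (fun s hs => ?_) (fun s hs => ?_) (fun s hs => ?_)
    (show i < 4 * M + 4 by omega)
  · rw [if_pos ⟨2 * s, by ring⟩]; exact (hg s hs).1
  · rw [if_neg (by simp [parity_simps])]; exact (hf (M - s) s (by omega)).2
  · rw [if_pos ⟨2 * s + 1, by ring⟩]; exact (hg s hs).2
  · rw [if_neg (by simp [parity_simps])]; exact (hf (M - s) s (by omega)).1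

lemma P3_eq_prod_grid (hj : Odd j) (hab : (j < |a| ∧ |b| < 1) ∨ (|a| < 1 ∧ j < |b|)) :
    P3 j a b α (2 * j + 2) = ∏ i ∈ Finset.range (2 * j + 2), (X - C (grid j a b i)) := by
  have hP : (P3 j a b α (2 * j + 2)).Monic ∧ (P3 j a b α (2 * j + 2)).natDegree = 2 * j + 2 :=
    monicRec_monic_natDegree _ _ (2 * j + 2)
  have hQ : (∏ i ∈ Finset.range (2 * j + 2), (X - C (grid j a b i))).Monic :=
    monic_prod_of_monic _ _ fun i _ => monic_X_sub_C _
  have hdP : (P3 j a b α (2 * j + 2)).degree = (2 * j + 2 : ℕ) := by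
    rw [degree_eq_natDegree hP.1.ne_zero, hP.2]
  have hdQ : (∏ i ∈ Finset.range (2 * j + 2), (X - C (grid j a b i))).degree
      = ((2 * j + 2 : ℕ) : WithBot ℕ) := by
    rw [degree_eq_natDegree hQ.ne_zero, natDegree_prod_of_monic _ _ fun i _ => monic_X_sub_C _]
    simp
  refine Polynomial.eq_of_degree_sub_lt_of_eval_index_eq _ (grid_injOn hj hab) ?_ fun i hi => ?_
  · rw [Finset.card_range, ← hdP]
    exact degree_sub_lt_left (hdP.trans hdQ.symm) hP.1.ne_zero (by rw [hP.1, hQ])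
  · rw [(P3_eval_grid hj hab (Finset.mem_range.1 hi)).1, eval_prod, Finset.prod_eq_zero hi]
    simp

end Spectrum

/-! ### Reversal of the recurrence -/

section Reversal

variable {j : ℕ} {a b α : ℝ}

lemma P3_add_two (n : ℕ) : P3 j a b α (n + 2)
    = (X - C ((b - j - 1 + a) / 4 - A3 j a b α (n + 1) - C3 j a b α (n + 1)))
        * P3 j a b α (n + 1) - C (u3 j a b α (n + 1)) * P3 j a b α n := rfl

lemma u3_reflect (hj : Odd j) {n m : ℕ} (h : n + m = 2 * j) :
    u3 j a b (1 - α) (m + 1) = u3 j a b α (n + 1) := by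
  have h1 := A3_reflect a b α hj (n := n + 1) (by omega)
  have h2 := C3_reflect a b α hj (n := n) (by omega)
  rw [show 2 * j + 1 - (n + 1) = m by omega] at h1
  rw [show 2 * j + 1 - n = m + 1 by omega] at h2
  simp only [u3, Nat.add_sub_cancel, h1, h2, mul_comm]

/-- The recurrence with parameter `1 - α` is the recurrence with parameter `α` read backwards. -/
lemma P3_last_mul_eval (hj : Odd j) {x : ℝ} (hx : (P3 j a b (1 - α) (2 * j + 2)).eval x = 0)
    {n m : ℕ} (hnm : n + m = 2 * j + 1) :
    (P3 j a b (1 - α) (2 * j + 1)).eval x * (P3 j a b α n).eval x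
      = (∏ i ∈ Finset.range n, u3 j a b α (i + 1)) * (P3 j a b (1 - α) m).eval x := by
  have hrec : ∀ n m, n + m = 2 * j → (P3 j a b (1 - α) (m + 2)).eval x
      = (x - ((b - j - 1 + a) / 4 - A3 j a b α n - C3 j a b α n))
          * (P3 j a b (1 - α) (m + 1)).eval x
        - u3 j a b α (n + 1) * (P3 j a b (1 - α) m).eval x := fun n m h => by
    have h1 := A3_reflect a b α hj (n := n) (by omega)
    have h2 := C3_reflect a b α hj (n := n) (by omega)
    rw [show 2 * j + 1 - n = m + 1 by omega] at h1 h2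
    rw [P3_add_two, u3_reflect hj h, h1, h2]
    simp only [eval_sub, eval_mul, eval_X, eval_C]
    ring
  induction n using Nat.twoStepInduction generalizing m with
  | zero =>
    obtain rfl : m = 2 * j + 1 := by omega
    simp [P3, monicRec]
  | one =>
    obtain rfl : m = 2 * j := by omega
    -- Vanishing of $P_{2j+2}$ at $x$ plays the role of $P_{-1}=0$ for the reversed recurrence.
    have h := hrec 0 (2 * j) (by omega)
    rw [hx] at h
    rw [show P3 j a b α 1 = X - C ((b - j - 1 + a) / 4 - A3 j a b α 0 - C3 j a b α 0) from rfl]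
    simp only [eval_sub, eval_X, eval_C, Finset.prod_range_one]
    linear_combination -h
  | more n h0 h1 =>
    have e0 := h0 (m := m + 2) (by omega)
    have e1 := h1 (m := m + 1) (by omega)
    have h := hrec (n + 1) m (by omega)
    rw [P3_add_two, Finset.prod_range_succ, Finset.prod_range_succ]
    rw [Finset.prod_range_succ] at e1
    simp only [eval_sub, eval_mul, eval_X, eval_C]
    linear_combination (x - ((b - j - 1 + a) / 4 - A3 j a b α (n + 1) - C3 j a b α (n + 1))) * e1
      - u3 j a b α (n + 1) * e0
      - (∏ i ∈ Finset.range n, u3 j a b α (i + 1)) * u3 j a b α (n + 1) * h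

lemma prod_range_two_mul_add_one (f : ℕ → ℝ) (n : ℕ) :
    ∏ i ∈ Finset.range (2 * n + 1), f i
      = f n * ∏ i ∈ Finset.range n, (f i * f (2 * n - i)) := by
  rw [show 2 * n + 1 = n + 1 + n by ring, Finset.prod_range_add, Finset.prod_range_succ,
    Finset.prod_mul_distrib, ← Finset.prod_range_reflect (fun x => f (n + 1 + x))]
  rw [Finset.prod_congr rfl fun i hi => show f (n + 1 + (n - 1 - i)) = f (2 * n - i) by
    have := Finset.mem_range.1 hi
    congr 1
    omega]
  ring

lemma A3_congr {n : ℕ} (hn : n ≠ j) (α' : ℝ) : A3 j a b α n = A3 j a b α' n := by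
  by_cases he : Even n
  · rw [A3_even a b _ he, A3_even a b _ he]
  · rw [A3_odd a b _ he hn, A3_odd a b _ he hn]

/-- For even $n$ the indices $n$ and $2j-n$ give opposite $m=n-j$, and the product is
$-(m^2-a^2)(m^2-b^2)/(16m^2)$; for odd $n$ both factors are negative. -/
lemma A3_mul_A3_nonneg (hj : Odd j) (hab : (j < |a| ∧ |b| < 1) ∨ (|a| < 1 ∧ j < |b|)) {n : ℕ}
    (hn : n < j) : 0 ≤ A3 j a b α n * A3 j a b α (2 * j - n) := by
  have hc : ((2 * j - n : ℕ) : ℝ) = 2 * j - n := by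
    rw [Nat.cast_sub (by omega)]; push_cast; rfl
  have he' : Even (2 * j - n) ↔ Even n := by
    rw [Nat.even_sub (by omega)]; simp
  by_cases he : Even n
  · have h0 := cast_sub_ne_zero_of_even hj he
    have h1 : (2 * j - n : ℝ) - j ≠ 0 := fun h => h0 (by linarith)
    have h2 := mul_sq_sub_neg hab (one_le_sq_cast_sub hj he) (sq_cast_sub_le (by omega))
    rw [A3_even a b _ he, A3_even a b _ (he'.2 he), hc]
    have h3 : 1 / 4 * (((n : ℝ) - j + a) * (n - j + b) / (n - j))
        * (1 / 4 * ((2 * j - n - j + a) * (2 * j - n - j + b) / (2 * j - n - j)))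
        = -(((n - j : ℝ) ^ 2 - a ^ 2) * ((n - j) ^ 2 - b ^ 2)) / (16 * (n - j) ^ 2) := by
      rw [show (2 * j - n - j : ℝ) = -(n - j) by ring]
      field_simp
      ring
    rw [h3]
    exact div_nonneg (by linarith) (by positivity)
  · have h1 : (n : ℝ) + 1 ≤ j := by exact_mod_cast hn
    have h2 : (0 : ℝ) ≤ n := n.cast_nonneg
    rw [A3_odd a b _ he (by omega), A3_odd a b _ (he'.not.2 he) (by omega), hc]
    exact mul_nonneg_of_nonpos_of_nonpos (by linarith) (by linarith)

/-- Up to sign, the values of `P_{2j+1}` on the grid are `2 α H` and `2 (1 - α) H`. -/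
lemma lastValue_eq (hj : Odd j) : lastValue j a b α = 2 * α * lastValue j a b (1 / 2) := by
  rw [lastValue, lastValue, prod_range_two_mul_add_one, prod_range_two_mul_add_one, A3_self a b _ hj,
    A3_self a b _ hj]
  rw [Finset.prod_congr rfl fun i hi => show A3 j a b α i * A3 j a b α (2 * j - i)
    = A3 j a b (1 / 2) i * A3 j a b (1 / 2) (2 * j - i) by
      have := Finset.mem_range.1 hi
      rw [A3_congr (by omega) (1 / 2), A3_congr (n := 2 * j - i) (by omega) (1 / 2)]]
  ring

lemma lastValue_nonpos (hj : Odd j) (hab : (j < |a| ∧ |b| < 1) ∨ (|a| < 1 ∧ j < |b|))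
    (hα : 0 ≤ α) : lastValue j a b α ≤ 0 := by
  rw [lastValue, prod_range_two_mul_add_one, A3_self a b _ hj]
  refine mul_nonpos_of_nonpos_of_nonneg ?_
    (Finset.prod_nonneg fun i hi => A3_mul_A3_nonneg hj hab (Finset.mem_range.1 hi))
  have : 0 ≤ α * ((j : ℝ) + 1) := by positivity
  linarith

/-- At $\alpha=1-\alpha=\frac12$, reversal with $n=2j+1$, $m=0$ gives $P_{2j+1}(x_i)^2=u_1\cdots
u_{2j+1}=H^2$. The points $x_0,x_1$ represent the two chains, and `lastValue_nonpos` fixes the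
signs. -/
lemma neg_lastValue_half (hj : Odd j) (hab : (j < |a| ∧ |b| < 1) ∨ (|a| < 1 ∧ j < |b|)) :
    -lastValue j a b (1 / 2) = norm3 j a b (1 / 2) (2 * j + 1) ∧
      -lastValue j a (-b) (1 / 2) = norm3 j a b (1 / 2) (2 * j + 1) := by
  have hhalf : (1 : ℝ) - 1 / 2 = 1 / 2 := by norm_num
  have hsq : ∀ i < 2 * j + 2, (P3 j a b (1 / 2) (2 * j + 1)).eval (grid j a b i) ^ 2
      = norm3 j a b (1 / 2) (2 * j + 1) ^ 2 := fun i hi => by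
    have h := P3_last_mul_eval (α := 1 / 2) hj
      (P3_eval_grid hj hab (α := 1 - 1 / 2) hi).1 (n := 2 * j + 1) (m := 0) rfl
    rw [← norm3_sq hj hab (by norm_num) (by norm_num) le_rfl, hhalf] at h
    rw [sq, h]
    simp [P3, monicRec]
  have h0 := hsq 0 (by omega)
  have h1 := hsq 1 (by omega)
  rw [(P3_eval_grid hj hab (by omega)).2] at h0 h1
  rw [if_pos (by simp), hhalf] at h0
  rw [if_neg (by simp), ← neg_sq] at h1
  have hab' : (j < |a| ∧ |-b| < 1) ∨ (|a| < 1 ∧ j < |-b|) := by rwa [abs_neg]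
  have hn := lastValue_nonpos (α := 1 / 2) hj hab (by norm_num)
  have hn' := lastValue_nonpos (α := 1 / 2) hj hab' (by norm_num)
  exact ⟨(sq_eq_sq₀ (by linarith) (norm3_nonneg _)).1 h1,
    (sq_eq_sq₀ (by linarith) (norm3_nonneg _)).1 h0⟩

lemma P3_last_eval_grid (hj : Odd j) (hab : (j < |a| ∧ |b| < 1) ∨ (|a| < 1 ∧ j < |b|)) {i : ℕ}
    (hi : i < 2 * j + 2) : (P3 j a b (1 - α) (2 * j + 1)).eval (grid j a b i)
      = if Even i then 2 * α * norm3 j a b (1 / 2) (2 * j + 1)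
        else -(2 * (1 - α) * norm3 j a b (1 / 2) (2 * j + 1)) := by
  obtain ⟨h1, h2⟩ := neg_lastValue_half hj hab
  rw [(P3_eval_grid hj hab hi).2, sub_sub_cancel, lastValue_eq hj, lastValue_eq hj (α := 1 - α)]
  split_ifs
  · rw [← h2]; ring
  · rw [← h1]; ring

end Reversal

/-! ### Weights and orthogonality -/

section Weights

lemma prod_range_eq_poch {f : ℕ → ℝ} {c : ℝ} (h : ∀ t, f t = c + t) (k : ℕ) :
    ∏ t ∈ Finset.range k, f t = poch c k := Finset.prod_congr rfl fun t _ => h t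

lemma prod_range_eq_neg_poch {f : ℕ → ℝ} {c : ℝ} (h : ∀ t, f t = -(c + t)) (k : ℕ) :
    ∏ t ∈ Finset.range k, f t = (-1) ^ k * poch c k := by
  simp only [h, Finset.prod_neg, Finset.card_range, poch]

lemma prod_erase_eq_prod_ite {s : Finset ℕ} {i : ℕ} (hi : i ∈ s) (f : ℕ → ℝ) :
    ∏ k ∈ s.erase i, f k = ∏ k ∈ s, if k = i then 1 else f k := by
  rw [← Finset.mul_prod_erase s _ hi, if_pos rfl, one_mul]
  exact Finset.prod_congr rfl fun k hk => (if_neg (Finset.ne_of_mem_erase hk)).symm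

lemma prod_range_erase_eq_poch {f : ℕ → ℝ} {s K : ℕ} (hs : s ≤ K) (h : ∀ t, f t = t - s) :
    ∏ t ∈ (Finset.range (K + 1)).erase s, f t = poch (-s) s * poch 1 (K - s) := by
  obtain ⟨d, rfl⟩ := Nat.exists_eq_add_of_le hs
  rw [prod_erase_eq_prod_ite (Finset.mem_range.2 (by omega)), add_right_comm, Finset.prod_range_add,
    Finset.prod_range_succ, if_pos rfl, mul_one, Nat.add_sub_cancel_left]
  congr 1
  · refine Finset.prod_congr rfl fun t ht => ?_
    rw [if_neg (Finset.mem_range.1 ht).ne, h]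
    ring
  · refine Finset.prod_congr rfl fun t _ => ?_
    rw [if_neg (by omega), h]
    push_cast
    ring

lemma prod_range_erase_eq_neg_poch {f : ℕ → ℝ} {s K : ℕ} (hs : s ≤ K) (h : ∀ t, f t = s - t) :
    ∏ t ∈ (Finset.range (K + 1)).erase s, f t
      = (-1) ^ K * (poch (-s) s * poch 1 (K - s)) := by
  rw [← prod_range_erase_eq_poch (f := fun t => -f t) hs fun t => by rw [h]; ring,
    Finset.prod_neg, Finset.card_erase_of_mem (Finset.mem_range.2 (by omega)), Finset.card_range,
    Nat.add_sub_cancel, ← mul_assoc, ← mul_pow]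
  simp

lemma prod_range_four_mul (f : ℕ → ℝ) (K : ℕ) : ∏ k ∈ Finset.range (4 * K), f k
    = (∏ t ∈ Finset.range K, f (4 * t)) * (∏ t ∈ Finset.range K, f (4 * t + 1))
      * (∏ t ∈ Finset.range K, f (4 * t + 2)) * ∏ t ∈ Finset.range K, f (4 * t + 3) := by
  induction K with
  | zero => simp
  | succ K ih =>
    rw [show 4 * (K + 1) = 4 * K + 1 + 1 + 1 + 1 by ring]
    simp only [Finset.prod_range_succ, ih]
    ring

lemma prod_range_four_mul_erase (f : ℕ → ℝ) {K s : ℕ} (hs : s < K) :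
    (∏ k ∈ (Finset.range (4 * K)).erase (4 * s), f k
      = (∏ t ∈ (Finset.range K).erase s, f (4 * t)) * (∏ t ∈ Finset.range K, f (4 * t + 1))
        * (∏ t ∈ Finset.range K, f (4 * t + 2)) * ∏ t ∈ Finset.range K, f (4 * t + 3)) ∧
    (∏ k ∈ (Finset.range (4 * K)).erase (4 * s + 1), f k
      = (∏ t ∈ Finset.range K, f (4 * t)) * (∏ t ∈ (Finset.range K).erase s, f (4 * t + 1))
        * (∏ t ∈ Finset.range K, f (4 * t + 2)) * ∏ t ∈ Finset.range K, f (4 * t + 3)) ∧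
    (∏ k ∈ (Finset.range (4 * K)).erase (4 * s + 2), f k
      = (∏ t ∈ Finset.range K, f (4 * t)) * (∏ t ∈ Finset.range K, f (4 * t + 1))
        * (∏ t ∈ (Finset.range K).erase s, f (4 * t + 2)) * ∏ t ∈ Finset.range K, f (4 * t + 3)) ∧
    (∏ k ∈ (Finset.range (4 * K)).erase (4 * s + 3), f k
      = (∏ t ∈ Finset.range K, f (4 * t)) * (∏ t ∈ Finset.range K, f (4 * t + 1))
        * (∏ t ∈ Finset.range K, f (4 * t + 2)) *
          ∏ t ∈ (Finset.range K).erase s, f (4 * t + 3)) := by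
  have hs' : s ∈ Finset.range K := Finset.mem_range.2 hs
  refine ⟨?_, ?_, ?_, ?_⟩ <;>
  · rw [prod_erase_eq_prod_ite (Finset.mem_range.2 (by omega)), prod_range_four_mul,
      prod_erase_eq_prod_ite hs']
    refine congrArg₂ _ (congrArg₂ _ (congrArg₂ _ ?_ ?_) ?_) ?_ <;>
    first
    | exact Finset.prod_congr rfl fun t _ => if_neg (by omega)
    | exact Finset.prod_congr rfl fun t _ => if_congr (by omega) rfl rfl

variable {j : ℕ} {a b α : ℝ}

/-- The denominator is $P_{2j+2}'(x_i)$. Split by residue mod 4, its factors form arithmetic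
progressions of step $\pm1$, hence Pochhammer symbols up to powers of $-1$. -/
lemma weight_eq (hj : Odd j) (hab : (j < |a| ∧ |b| < 1) ∨ (|a| < 1 ∧ j < |b|)) {i : ℕ}
    (hi : i < 2 * j + 2) : weight j a b α i
      = (P3 j a b (1 - α) (2 * j + 1)).eval (grid j a b i)
        / ∏ k ∈ (Finset.range (2 * j + 2)).erase i, (grid j a b i - grid j a b k) := by
  rw [P3_last_eval_grid hj hab hi]
  obtain ⟨M, hM⟩ := hj
  have hk : (j + 1) / 2 = M + 1 := by omega
  have hk' : (j - 1) / 2 = M := by omega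
  -- In each class exactly two of the four products carry signs, and these combine to $\pm1$
  -- independently of $M$.
  have hpow : (-1 : ℝ) ^ M * (-1) ^ M = 1 := by rw [← mul_pow]; simp
  have hN : 2 * j + 2 = 4 * (M + 1) := by omega
  rw [hN]
  refine forall_lt_four_mul_add_four (M := M) (p := fun i => weight j a b α i
      = (if Even i then 2 * α * norm3 j a b (1 / 2) (2 * j + 1)
        else -(2 * (1 - α) * norm3 j a b (1 / 2) (2 * j + 1)))
        / ∏ k ∈ (Finset.range (4 * (M + 1))).erase i, (grid j a b i - grid j a b k))
    (fun s hs => ?_) (fun s hs => ?_) (fun s hs => ?_) (fun s hs => ?_)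
    (show i < 4 * M + 4 by omega)
  · have h1 : 4 * s / 4 = s := by omega
    have h2 : 4 * s % 4 = 0 := by omega
    rw [if_pos ⟨2 * s, by ring⟩, (prod_range_four_mul_erase _ (by omega)).1,
      prod_range_erase_eq_poch hs (fun t => by rw [grid_zero, grid_zero]; ring),
      prod_range_eq_neg_poch (c := s - (b + j) / 2) (fun t => by rw [grid_zero, grid_one]; ring),
      prod_range_eq_neg_poch (c := s + (1 + a - b - j) / 2)
        (fun t => by rw [grid_zero, grid_two]; ring),
      prod_range_eq_poch (c := -s + (1 - a) / 2) (fun t => by rw [grid_zero, grid_three]; ring)]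
    simp only [weight, h1, h2, hk, hk', if_true]
    congr 1
    linear_combination (-1 : ℝ) * (poch (-s) s * poch 1 (M - s) * poch (-s + (1 - a) / 2) (M + 1)
      * poch (s + (1 + a - b - j) / 2) (M + 1) * poch (s - (b + j) / 2) (M + 1)) * hpow
  · have h1 : (4 * s + 1) / 4 = s := by omega
    have h2 : (4 * s + 1) % 4 = 1 := by omega
    rw [if_neg (by simp [parity_simps]), (prod_range_four_mul_erase _ (by omega)).2.1,
      prod_range_erase_eq_neg_poch hs (fun t => by rw [grid_one, grid_one]; ring),
      prod_range_eq_poch (c := s - (b + j) / 2) (fun t => by rw [grid_zero, grid_one]; ring),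
      prod_range_eq_neg_poch (c := -s + (1 + a) / 2)
        (fun t => by rw [grid_one, grid_two]; ring),
      prod_range_eq_poch (c := s + (1 - a - b - j) / 2)
        (fun t => by rw [grid_one, grid_three]; ring)]
    simp only [weight, h1, h2, hk, hk', if_true, one_ne_zero, if_false]
    rw [← neg_div_neg_eq]
    congr 1
    linear_combination (poch (-s) s * poch 1 (M - s) * poch (-s + (1 + a) / 2) (M + 1)
      * poch (s + (1 - a - b - j) / 2) (M + 1) * poch (s - (b + j) / 2) (M + 1)) * hpow
  · have h1 : (4 * s + 2) / 4 = s := by omega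
    have h2 : (4 * s + 2) % 4 = 2 := by omega
    rw [if_pos ⟨2 * s + 1, by ring⟩, (prod_range_four_mul_erase _ (by omega)).2.2.1,
      prod_range_erase_eq_neg_poch hs (fun t => by rw [grid_two, grid_two]; ring),
      prod_range_eq_poch (c := s + (1 + a - b - j) / 2)
        (fun t => by rw [grid_zero, grid_two]; ring),
      prod_range_eq_neg_poch (c := -s - (1 + a) / 2)
        (fun t => by rw [grid_one, grid_two]; ring),
      prod_range_eq_poch (c := s + (2 - b - j) / 2)
        (fun t => by rw [grid_two, grid_three]; ring)]
    simp only [weight, h1, h2, hk, hk']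
    norm_num only [if_true, if_false]
    rw [← div_neg]
    congr 1
    linear_combination (poch (-s) s * poch 1 (M - s) * poch (-s - (1 + a) / 2) (M + 1)
      * poch (s + (1 + a - b - j) / 2) (M + 1) * poch (s + (2 - b - j) / 2) (M + 1)) * hpow
  · have h1 : (4 * s + 3) / 4 = s := by omega
    have h2 : (4 * s + 3) % 4 = 3 := by omega
    rw [if_neg (by simp [parity_simps]), (prod_range_four_mul_erase _ (by omega)).2.2.2,
      prod_range_erase_eq_poch hs (fun t => by rw [grid_three, grid_three]; ring),
      prod_range_eq_poch (c := -s - (1 - a) / 2)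
        (fun t => by rw [grid_zero, grid_three]; ring),
      prod_range_eq_neg_poch (c := s + (1 - a - b - j) / 2)
        (fun t => by rw [grid_one, grid_three]; ring),
      prod_range_eq_neg_poch (c := s + (2 - b - j) / 2)
        (fun t => by rw [grid_two, grid_three]; ring)]
    simp only [weight, h1, h2, hk, hk']
    norm_num only [if_true, if_false]
    rw [← neg_div]
    congr 1
    linear_combination (-1 : ℝ) * (poch (-s) s * poch 1 (M - s) * poch (-s - (1 - a) / 2) (M + 1)
      * poch (s + (1 - a - b - j) / 2) (M + 1) * poch (s + (2 - b - j) / 2) (M + 1)) * hpow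

lemma P3_monic_natDegree (n : ℕ) :
    (P3 j a b α n).Monic ∧ (P3 j a b α n).natDegree = n := monicRec_monic_natDegree _ _ n

/-- Reversal trades $P_n$ for $P^{1-\alpha}_{2j+1-n}$, so the summands become those of the Lagrange
formula for a leading coefficient. The product has degree $2j+1-n+m\le2j+1$, with equality only for
$m=n$, where it is monic. -/
lemma sum_weight_of_le (hj : Odd j) (hab : (j < |a| ∧ |b| < 1) ∨ (|a| < 1 ∧ j < |b|))
    (h0 : 0 ≤ α) (h1 : α ≤ 1) {n m : ℕ} (hn : n ≤ 2 * j + 1) (hm : m ≤ n) :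
    ∑ i ∈ Finset.range (2 * j + 2), weight j a b α i * (P3 j a b α n).eval (grid j a b i)
        * (P3 j a b α m).eval (grid j a b i)
      = if n = m then norm3 j a b α n ^ 2 else 0 := by
  have hR := P3_monic_natDegree (j := j) (a := a) (b := b) (α := 1 - α) (2 * j + 1 - n)
  have hP := P3_monic_natDegree (j := j) (a := a) (b := b) (α := α) m
  have hd : (P3 j a b (1 - α) (2 * j + 1 - n) * P3 j a b α m).natDegree = 2 * j + 1 - n + m := by
    rw [hR.1.natDegree_mul hP.1, hR.2, hP.2]
  have hsum : ∑ i ∈ Finset.range (2 * j + 2), weight j a b α i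
        * (P3 j a b α n).eval (grid j a b i) * (P3 j a b α m).eval (grid j a b i)
      = norm3 j a b α n ^ 2
        * (P3 j a b (1 - α) (2 * j + 1 - n) * P3 j a b α m).coeff (2 * j + 1) := by
    have hc := Lagrange.coeff_eq_sum (grid_injOn hj hab)
      (P := P3 j a b (1 - α) (2 * j + 1 - n) * P3 j a b α m) (by
        rw [degree_eq_natDegree (hR.1.mul hP.1).ne_zero, hd, Finset.card_range]
        exact_mod_cast (by omega))
    rw [Finset.card_range, show 2 * j + 2 - 1 = 2 * j + 1 by omega] at hc
    rw [hc, Finset.mul_sum, norm3_sq hj hab h0 h1 hn]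
    refine Finset.sum_congr rfl fun i hi => ?_
    have hi := Finset.mem_range.1 hi
    have h := P3_last_mul_eval (α := α) hj (P3_eval_grid hj hab (α := 1 - α) hi).1
      (n := n) (m := 2 * j + 1 - n) (by omega)
    rw [weight_eq hj hab hi, eval_mul, div_mul_eq_mul_div, h]
    ring
  rw [hsum]
  split_ifs with hnm
  · subst hnm
    have hd' : 2 * j + 1 - n + n = 2 * j + 1 := by omega
    have hc := (hR.1.mul hP.1).coeff_natDegree
    rw [hd, hd'] at hc
    rw [hc, mul_one]
  · rw [coeff_eq_zero_of_natDegree_lt (by omega), mul_zero]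

end Weights

end ParaBI

theorem mainTheorem12 (j : ℕ) (hj : Odd j) (a b α : ℝ) :
    -- truncation of the general Bannai-Ito polynomials
    (∀ (e₁ e₂ ρ₁ r₁ : ℝ) (ρ₂ r₂ : ℝ → ℝ), e₁ + e₂ ≠ 0 → e₁ / (e₁ + e₂) = α →
      ρ₁ = (b - j - 1 + a) / 4 → -r₁ = (b - j - 1 - a) / 4 →
      (∀ t, ρ₁ + ρ₂ t = -((j + 1) / 2) + e₁ * t) →
      (∀ t, -r₁ - r₂ t = -((j + 1) / 2) + e₂ * t) →
      ∀ n : ℕ,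
        Tendsto (fun t => ParaBI.genC ρ₁ (ρ₂ t) r₁ (r₂ t) n) (𝓝[≠] 0)
          (𝓝 (ParaBI.A3 j a b α n)) ∧
        Tendsto (fun t => ParaBI.genA ρ₁ (ρ₂ t) r₁ (r₂ t) n) (𝓝[≠] 0)
          (𝓝 (ParaBI.C3 j a b α (n + 1))) ∧
        ∀ x : ℝ, Tendsto (fun t => (ParaBI.genB ρ₁ (ρ₂ t) r₁ (r₂ t) n).eval x) (𝓝[≠] 0)
          (𝓝 ((ParaBI.P3 j a b α n).eval x))) ∧
    -- recurrence relation, and its truncation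
    (∀ n : ℕ, (ParaBI.P3 j a b α n).Monic ∧ (ParaBI.P3 j a b α n).natDegree = n) ∧
    X * ParaBI.P3 j a b α 0 = ParaBI.P3 j a b α 1
      + C ((b - j - 1 + a) / 4 - ParaBI.A3 j a b α 0 - ParaBI.C3 j a b α 0)
        * ParaBI.P3 j a b α 0 ∧
    (∀ n : ℕ, 1 ≤ n → X * ParaBI.P3 j a b α n = ParaBI.P3 j a b α (n + 1)
      + C ((b - j - 1 + a) / 4 - ParaBI.A3 j a b α n - ParaBI.C3 j a b α n)
        * ParaBI.P3 j a b α n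
      + C (ParaBI.A3 j a b α (n - 1) * ParaBI.C3 j a b α n) * ParaBI.P3 j a b α (n - 1)) ∧
    ParaBI.C3 j a b α 0 = 0 ∧ ParaBI.A3 j a b α (2 * j + 1) = 0 ∧
    -- positivity
    ((∀ n ∈ Finset.Icc 1 (2 * j + 1), 0 < ParaBI.A3 j a b α (n - 1) * ParaBI.C3 j a b α n) ↔
      ((j < |a| ∧ |b| < 1) ∨ (|a| < 1 ∧ j < |b|)) ∧ 0 < α ∧ α < 1) ∧
    (((j ≤ |a| ∧ |b| ≤ 1) ∨ (|a| ≤ 1 ∧ j ≤ |b|)) → 0 ≤ α → α ≤ 1 →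
      ∀ n ∈ Finset.Icc 1 (2 * j + 1),
        0 ≤ ParaBI.A3 j a b α (n - 1) * ParaBI.C3 j a b α n) ∧
    -- Dunkl-difference equation
    (∀ n : ℕ, n ≤ j → ∀ x : ℝ, x ≠ 0 → x ≠ -(1 / 2) →
      ParaBI.dunklL j a b (fun y => (ParaBI.P3 j a b α (2 * n)).eval y) x
        = n * (ParaBI.P3 j a b α (2 * n)).eval x ∧
      ParaBI.dunklL j a b (fun y => (ParaBI.P3 j a b α (2 * n + 1)).eval y) x
        = (j - n) * (ParaBI.P3 j a b α (2 * n + 1)).eval x) ∧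
    -- expression through the polynomials with `N = 2j`
    (ParaBI.P3 j a b α 0 = ParaBI.P2 j a b α 0 ∧
      ∀ n : ℕ, 1 ≤ n → ParaBI.P3 j a b α n
        = ParaBI.P2 j a b α n - C (ParaBI.C3 j a b α n) * ParaBI.P2 j a b α (n - 1)) ∧
    -- orthogonality on the bi-lattice
    (((j < |a| ∧ |b| < 1) ∨ (|a| < 1 ∧ j < |b|)) → 0 ≤ α → α ≤ 1 →
      Set.InjOn (ParaBI.grid j a b) (Finset.range (2 * j + 2)) ∧
      ParaBI.P3 j a b α (2 * j + 2)
        = ∏ i ∈ Finset.range (2 * j + 2), (X - C (ParaBI.grid j a b i)) ∧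
      (∀ n ≤ 2 * j + 1, ParaBI.norm3 j a b α n ^ 2
        = ∏ k ∈ Finset.Icc 1 n, (ParaBI.A3 j a b α (k - 1) * ParaBI.C3 j a b α k)) ∧
      ∀ n ≤ 2 * j + 1, ∀ m ≤ 2 * j + 1,
        ∑ i ∈ Finset.range (2 * j + 2), ParaBI.weight j a b α i
            * (ParaBI.P3 j a b α n).eval (ParaBI.grid j a b i)
            * (ParaBI.P3 j a b α m).eval (ParaBI.grid j a b i)
          = if n = m then ParaBI.norm3 j a b α n ^ 2 else 0) := by
  
  refine ⟨?_, fun n => ParaBI.P3_monic_natDegree n, ?_, ?_, ParaBI.C3_zero a b α,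
    ParaBI.A3_last a b α, ParaBI.u3_pos_iff hj, fun hab h0 h1 n hn =>
    ParaBI.u3_nonneg hj hab h0 h1 hn, fun n _ x hx hx' => ⟨ParaBI.dunklL_P3_even a b α hj n hx hx',
    ParaBI.dunklL_P3_odd a b α hj n hx hx'⟩, ⟨rfl, ?_⟩, fun hab h0 h1 =>
    ⟨ParaBI.grid_injOn hj hab, ParaBI.P3_eq_prod_grid hj hab, fun n hn => ?_, fun n hn m hm => ?_⟩⟩
  · intro e₁ e₂ ρ₁ r₁ ρ₂ r₂ he hα hρ₁ hr₁ hρ₂ hr₂ n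
    exact ⟨ParaBI.tendsto_genC hj he hα hρ₁ hr₁ hρ₂ hr₂ n,
      ParaBI.tendsto_genA hj he hα hρ₁ hr₁ hρ₂ hr₂ n,
      ParaBI.tendsto_eval_genB hj he hα hρ₁ hr₁ hρ₂ hr₂ n⟩
  · simp only [ParaBI.P3, ParaBI.monicRec]
    ring
  · intro n hn
    obtain ⟨n, rfl⟩ := Nat.exists_eq_add_of_le' hn
    rw [ParaBI.P3_add_two, ParaBI.u3, Nat.add_sub_cancel]
    ring
  · intro n hn
    obtain ⟨n, rfl⟩ := Nat.exists_eq_add_of_le' hn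
    rw [ParaBI.P2_eq_kernelPoly a b α hj, ParaBI.P2_eq_kernelPoly a b α hj]
    exact (ParaBI.darboux_relations _ _ _ (ParaBI.C3_zero a b α) n).1
  · rw [ParaBI.norm3_sq hj hab h0 h1 hn]
    exact (ParaBI.prod_Icc_one_eq_prod_range _ n).symm
  · rcases le_total m n with h | h
    · exact ParaBI.sum_weight_of_le hj hab h0 h1 hn h
    · have hs := ParaBI.sum_weight_of_le hj hab h0 h1 hm h
      rw [Finset.sum_congr rfl fun i _ => mul_right_comm _ _ _, hs]
      split_ifs with h1 h2 h2
      · rw [h1]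
      · exact absurd h1.symm h2
      · exact absurd h2.symm h1
      · rfl
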